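/- Let $d\in\{2,3\}$, let $\Omega\subset\mathbb R^d$ be a bounded polyhedral domain (a bounded, nonempty, connected open set whose boundary lies in finitely many hyperplanes), and let $\mathbb T_h$ be a finite conforming simplicial mesh of $\overline\Omega$: the elements are nondegenerate closed $d$-simplices with $\overline\Omega=\bigcup_{T\in\mathbb T_h}T$, and any two of them intersect in the subsimplex spanned by their common vertices (possibly empty). A face ($(d-1)$-dimensional subsimplex of an element) is a boundary face if it is contained in $\partial\Omega$; otherwise it is an interior face, shared by two elements $T_\natural,T_\sharp$. The jump of an elementwise defined quantity across a face $F$ is $[\![q]\!]_F=q|_{T_\natural}-q|_{T_\sharp}$ on an interior face and $[\![q]\!]_F=q|_T$ on a boundary face $F\subset T$; $n_F$ is a unit normal to $F$. Set - $V_h^{RT^0}=\{v\in L^1(\Omega)^d:\ v|_T(x)=a_T+b_T\,x,\ a_T\in\mathbb R^d,\ b_T\in\mathbb R,\ \forall T\in\mathbb T_h;\ [\![v\cdot n_F]\!]_F=0$ for every interior face $F\}$ (no condition on the boundary); - $V_{h0}^{CR}=\{\chi\in L^2(\Omega):\ \chi|_T\in\mathbb P^1(T)\ \forall T\in\mathbb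 T_h;\ \int_F[\![\chi]\!]_F\,ds=0$ for every interior and every boundary face $F\}$; - $V_{h0}^{M}$: the set of $\varphi\in L^2(\Omega)$ with $\varphi|_T\in\mathbb P^2(T)$ for all $T\in\mathbb T_h$, such that $\int_F[\![\partial\varphi/\partial n_F]\!]_F\,ds=0$ for every interior and every boundary face $F$, the average of $\varphi|_T$ over each $(d-2)$-dimensional subsimplex $S$ is the same for all elements $T$ having $S$ as a subsimplex, and this average is $0$ if $S\subset\partial\Omega$ (for $d=2$, $S$ is a vertex and the average is the value there). $H_0^1(\Omega)$ is the closure of $C_c^\infty(\Omega)$ in $H^1(\Omega)$. Below, $\nabla$, $\operatorname{div}$ and $\partial/\partial x_i$ are taken elementwise (as weak derivatives on the interior of each $T$); all of them exist in $L^2(T)$, and all integrands are integrable. Then for all $v_h\in V_h^{RT^0}$ and $\psi_h\in H_0^1(\Omega)+V_{h0}^{CR}$, $$\sum_{T\in\mathbb T_h}\int_T (v_h\cdot\nabla)\psi_h\,dx+\sum_{T\in\mathbb T_h}\int_T(\operatorname{div}v_h)\,\psi_h\,dx=0,$$ and for all $v_h\in V_h^{RT^0}$ and $\varphi_h\in V_{h0}^M$,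 $$\sum_{T\in\mathbb T_h}\int_T (v_h\cdot\nabla)\frac{\partial\varphi_h}{\partial x_i}\,dx+\sum_{T\in\mathbb T_h}\int_T(\operatorname{div}v_h)\,\frac{\partial\varphi_h}{\partial x_i}\,dx=0,\qquad i=1,\dots,d.$$ -/

import Mathlib

open MeasureTheory Filter Topology
open scoped ContDiff Pointwise

/-- The closed simplex spanned by a finite set of points. -/
def simplexHull {d : ℕ} (V : Finset (EuclideanSpace ℝ (Fin d))) :
    Set (EuclideanSpace ℝ (Fin d)) :=
  convexHull ℝ (V : Set (EuclideanSpace ℝ (Fin d)))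

/-- A bounded polyhedral domain: a bounded, connected, nonempty open set whose boundary lies in
finitely many hyperplanes `{x | ⟪a, x⟫ = b}`, `a ≠ 0`. -/
structure IsPolyhedralDomain {d : ℕ} (Ω : Set (EuclideanSpace ℝ (Fin d))) : Prop where
  isOpen : IsOpen Ω
  isConnected : IsConnected Ω
  isBounded : Bornology.IsBounded Ω
  frontier_subset : ∃ s : Finset (EuclideanSpace ℝ (Fin d) × ℝ), (∀ q ∈ s, q.1 ≠ 0) ∧
    frontier Ω ⊆ ⋃ q ∈ s, {x | inner ℝ q.1 x = q.2}

/-- A conforming simplicial mesh of `closure Ω`. Each element is given by its set of `d + 1`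
vertices; two elements meet in the common subsimplex spanned by their common vertices
(possibly empty), i.e. there are no hanging nodes. -/
structure IsConformingMesh {d : ℕ} (Ω : Set (EuclideanSpace ℝ (Fin d)))
    (𝒯 : Finset (Finset (EuclideanSpace ℝ (Fin d)))) : Prop where
  card_eq : ∀ T ∈ 𝒯, T.card = d + 1
  affineIndependent : ∀ T ∈ 𝒯, AffineIndependent ℝ ((↑) : T → EuclideanSpace ℝ (Fin d))
  cover : ⋃ T ∈ 𝒯, simplexHull T = closure Ω
  conforming : ∀ T ∈ 𝒯, ∀ T' ∈ 𝒯, simplexHull T ∩ simplexHull T' =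
    convexHull ℝ ((T : Set (EuclideanSpace ℝ (Fin d))) ∩ T')

/-- `S` spans a `k`-dimensional subsimplex of the simplex with vertex set `T`. -/
def IsSubsimplex {d : ℕ} (k : ℕ) (S T : Finset (EuclideanSpace ℝ (Fin d))) : Prop :=
  S ⊆ T ∧ S.card = k + 1

/-- `F` spans an interior face of the mesh, shared by the two distinct elements `T₁`, `T₂`. -/
structure IsInteriorFace {d : ℕ} (Ω : Set (EuclideanSpace ℝ (Fin d)))
    (𝒯 : Finset (Finset (EuclideanSpace ℝ (Fin d))))
    (F T₁ T₂ : Finset (EuclideanSpace ℝ (Fin d))) : Prop where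
  left_mem : T₁ ∈ 𝒯
  right_mem : T₂ ∈ 𝒯
  ne : T₁ ≠ T₂
  left : IsSubsimplex (d - 1) F T₁
  right : IsSubsimplex (d - 1) F T₂
  not_boundary : ¬ simplexHull F ⊆ frontier Ω

/-- `F` spans a face of the element `T` that lies on the boundary of `Ω`. -/
structure IsBoundaryFace {d : ℕ} (Ω : Set (EuclideanSpace ℝ (Fin d)))
    (𝒯 : Finset (Finset (EuclideanSpace ℝ (Fin d))))
    (F T : Finset (EuclideanSpace ℝ (Fin d))) : Prop where
  mem : T ∈ 𝒯
  face : IsSubsimplex (d - 1) F T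
  boundary : simplexHull F ⊆ frontier Ω

/-- `n` is a unit normal to the simplex spanned by `F`. For a face there are exactly two,
`n` and `-n`, and none of the conditions below depends on which one is taken. -/
def IsUnitNormal {d : ℕ} (F : Finset (EuclideanSpace ℝ (Fin d)))
    (n : EuclideanSpace ℝ (Fin d)) : Prop :=
  ‖n‖ = 1 ∧ ∀ p ∈ F, ∀ q ∈ F, inner ℝ n (p - q) = 0

/-- Test functions: `C_c^∞(U)`. -/
def IsTestFunction {d : ℕ} (U : Set (EuclideanSpace ℝ (Fin d)))
    (η : EuclideanSpace ℝ (Fin d) → ℝ) : Prop :=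
  ContDiff ℝ ∞ η ∧ HasCompactSupport η ∧ tsupport η ⊆ U

/-- `f ∈ H¹(U)` with weak gradient `G` on the open set `U`. -/
structure HasWeakGradient {d : ℕ} (U : Set (EuclideanSpace ℝ (Fin d)))
    (f : EuclideanSpace ℝ (Fin d) → ℝ)
    (G : EuclideanSpace ℝ (Fin d) → EuclideanSpace ℝ (Fin d)) : Prop where
  memLp : MemLp f 2 (volume.restrict U)
  memLp_gradient : MemLp G 2 (volume.restrict U)
  integral_eq : ∀ η, IsTestFunction U η → ∀ i : Fin d,
    ∫ x in U, f x * gradient η x i = - ∫ x in U, G x i * η x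

/-- `v ∈ H(div; U)` with weak divergence `D` on the open set `U`. -/
structure HasWeakDivergence {d : ℕ} (U : Set (EuclideanSpace ℝ (Fin d)))
    (v : EuclideanSpace ℝ (Fin d) → EuclideanSpace ℝ (Fin d))
    (D : EuclideanSpace ℝ (Fin d) → ℝ) : Prop where
  memLp : MemLp v 2 (volume.restrict U)
  memLp_divergence : MemLp D 2 (volume.restrict U)
  integral_eq : ∀ η, IsTestFunction U η →
    ∫ x in U, inner ℝ (v x) (gradient η x) = - ∫ x in U, D x * η x

/-- `G` is the broken (elementwise) gradient of `f`. -/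
def HasBrokenGradient {d : ℕ} (𝒯 : Finset (Finset (EuclideanSpace ℝ (Fin d))))
    (f : EuclideanSpace ℝ (Fin d) → ℝ)
    (G : EuclideanSpace ℝ (Fin d) → EuclideanSpace ℝ (Fin d)) : Prop :=
  ∀ T ∈ 𝒯, HasWeakGradient (interior (simplexHull T)) f G

/-- `D` is the broken (elementwise) divergence of `v`. -/
def HasBrokenDivergence {d : ℕ} (𝒯 : Finset (Finset (EuclideanSpace ℝ (Fin d))))
    (v : EuclideanSpace ℝ (Fin d) → EuclideanSpace ℝ (Fin d))
    (D : EuclideanSpace ℝ (Fin d) → ℝ) : Prop :=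
  ∀ T ∈ 𝒯, HasWeakDivergence (interior (simplexHull T)) v D

/-- `H₀¹(Ω)`: the closure of `C_c^∞(Ω)` in `H¹(Ω)`. -/
def H10 {d : ℕ} (Ω : Set (EuclideanSpace ℝ (Fin d))) : Set (EuclideanSpace ℝ (Fin d) → ℝ) :=
  {w | ∃ G, HasWeakGradient Ω w G ∧
    ∃ η : ℕ → EuclideanSpace ℝ (Fin d) → ℝ, (∀ k, IsTestFunction Ω (η k)) ∧
      Tendsto (fun k => eLpNorm (fun x => η k x - w x) 2 (volume.restrict Ω)) atTop (𝓝 0) ∧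
      Tendsto (fun k => eLpNorm (fun x => gradient (η k) x - G x) 2 (volume.restrict Ω))
        atTop (𝓝 0)}

/-- `f ∈ L²(Ω)` agrees (a.e.) on each element `T` with the polynomial `P T` of degree at most
`m`. The trace of `f` on a subsimplex of `T`, taken from `T`, is the restriction of `P T`. -/
structure IsPiecewisePolynomial {d : ℕ} (m : ℕ) (Ω : Set (EuclideanSpace ℝ (Fin d)))
    (𝒯 : Finset (Finset (EuclideanSpace ℝ (Fin d)))) (f : EuclideanSpace ℝ (Fin d) → ℝ)
    (P : Finset (EuclideanSpace ℝ (Fin d)) → MvPolynomial (Fin d) ℝ) : Prop where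
  memLp : MemLp f 2 (volume.restrict Ω)
  totalDegree_le : ∀ T ∈ 𝒯, (P T).totalDegree ≤ m
  eq_poly : ∀ T ∈ 𝒯, ∀ᵐ x ∂(volume.restrict (simplexHull T)),
    f x = MvPolynomial.eval (fun i => x i) (P T)

/-- The directional derivative `n · ∇p` of a polynomial at `x`. -/
noncomputable def polyDirDeriv {d : ℕ} (n : EuclideanSpace ℝ (Fin d))
    (p : MvPolynomial (Fin d) ℝ) (x : EuclideanSpace ℝ (Fin d)) : ℝ :=
  ∑ i, n i * MvPolynomial.eval (fun j => x j) (MvPolynomial.pderiv i p)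

/-- The lowest-order Raviart--Thomas space: on each element `T`, `v x = a T + b T • x`, and the
normal components of the two one-sided traces agree on every interior face. -/
def RT0Space {d : ℕ} (Ω : Set (EuclideanSpace ℝ (Fin d)))
    (𝒯 : Finset (Finset (EuclideanSpace ℝ (Fin d)))) :
    Set (EuclideanSpace ℝ (Fin d) → EuclideanSpace ℝ (Fin d)) :=
  {v | MemLp v 1 (volume.restrict Ω) ∧
    ∃ (a : Finset (EuclideanSpace ℝ (Fin d)) → EuclideanSpace ℝ (Fin d))
      (b : Finset (EuclideanSpace ℝ (Fin d)) → ℝ),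
      (∀ T ∈ 𝒯, ∀ᵐ x ∂(volume.restrict (simplexHull T)), v x = a T + b T • x) ∧
      ∀ F T₁ T₂, IsInteriorFace Ω 𝒯 F T₁ T₂ → ∀ n, IsUnitNormal F n → ∀ x ∈ simplexHull F,
        inner ℝ (a T₁ + b T₁ • x) n - inner ℝ (a T₂ + b T₂ • x) n = 0}

/-- The Crouzeix--Raviart space with homogeneous boundary condition: piecewise affine functions
whose jump has vanishing integral over every face. -/
def CR0Space {d : ℕ} (Ω : Set (EuclideanSpace ℝ (Fin d)))
    (𝒯 : Finset (Finset (EuclideanSpace ℝ (Fin d)))) : Set (EuclideanSpace ℝ (Fin d) → ℝ) :=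
  {f | ∃ P, IsPiecewisePolynomial 1 Ω 𝒯 f P ∧
    (∀ F T₁ T₂, IsInteriorFace Ω 𝒯 F T₁ T₂ →
      ∫ x in simplexHull F, (MvPolynomial.eval (fun i => x i) (P T₁) -
        MvPolynomial.eval (fun i => x i) (P T₂)) ∂μHE[d - 1] = 0) ∧
    (∀ F T, IsBoundaryFace Ω 𝒯 F T →
      ∫ x in simplexHull F, MvPolynomial.eval (fun i => x i) (P T) ∂μHE[d - 1] = 0)}

/-- The Morley space with homogeneous boundary conditions: piecewise quadratic functions
such that the jump of the normal derivative has vanishing integral over every interior face,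
the average over each `(d-2)`-dimensional subsimplex of an element is the same from all elements
containing it, and the normal derivative averages over boundary faces and the averages over
`(d-2)`-dimensional subsimplexes on the boundary vanish. For `d = 2` the measure `μHE[d - 2]`
is the counting measure and these averages are values at vertices. -/
def Morley0Space {d : ℕ} (Ω : Set (EuclideanSpace ℝ (Fin d)))
    (𝒯 : Finset (Finset (EuclideanSpace ℝ (Fin d)))) : Set (EuclideanSpace ℝ (Fin d) → ℝ) :=
  {f | ∃ P, IsPiecewisePolynomial 2 Ω 𝒯 f P ∧
    (∀ F T₁ T₂, IsInteriorFace Ω 𝒯 F T₁ T₂ → ∀ n, IsUnitNormal F n →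
      ∫ x in simplexHull F, (polyDirDeriv n (P T₁) x - polyDirDeriv n (P T₂) x) ∂μHE[d - 1] = 0) ∧
    (∀ S, ∀ T₁ ∈ 𝒯, ∀ T₂ ∈ 𝒯, IsSubsimplex (d - 2) S T₁ → IsSubsimplex (d - 2) S T₂ →
      ⨍ x in simplexHull S, MvPolynomial.eval (fun i => x i) (P T₁) ∂μHE[d - 2] =
        ⨍ x in simplexHull S, MvPolynomial.eval (fun i => x i) (P T₂) ∂μHE[d - 2]) ∧
    (∀ F T, IsBoundaryFace Ω 𝒯 F T → ∀ n, IsUnitNormal F n →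
      ⨍ x in simplexHull F, polyDirDeriv n (P T) x ∂μHE[d - 1] = 0) ∧
    (∀ S, ∀ T ∈ 𝒯, IsSubsimplex (d - 2) S T → simplexHull S ⊆ frontier Ω →
      ⨍ x in simplexHull S, MvPolynomial.eval (fun i => x i) (P T) ∂μHE[d - 2] = 0)}

/-! The identity is an elementwise divergence theorem, proved without surface integrals in the
integration by parts. On a simplex with vertices `p`, a field `a + β x` is a combination `∑ c_p (x -
p)`. The field `x - p` is tangent to every face through `p`, so the integral of `div (g (x - p))`,
called `coneFlux`, depends only on the values of `g` on the face opposite to `p`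
(`coneFlux_eq_zero`). The sum over the mesh thus becomes a sum over pairs (element, opposite face)
of `c_p * coneFlux`.

Let `T`, `T'` share a face, with opposite vertices `p`, `p'`, and let `λ` be the barycentric
coordinate of `p` in `T`. The shear fixing the face and sending `p` to `p'` has determinant `λ p' <
0`, so the flux for `T'` is `-λ p'` times the flux for `T` (`coneFlux_neighbor`), while continuity
of the normal component gives `c_p = λ p' * c_p'` (`coeff_eq_of_normal_jump`). Hence the two terms
cancel as soon as the jump of `g` has zero flux (`sum_setIntegral_eq_zero`).

For affine `g` the flux is proportional to the sum of the vertex values on the face, as is the face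
integral, which settles Crouzeix-Raviart functions. Test functions have no jump and vanish on the
boundary; `H10` follows by density. Finally, partial derivatives of Morley functions are
Crouzeix-Raviart functions: normal derivative means are controlled by definition, and tangential
ones by the means over `(d - 2)`-subsimplexes (`sum_polyDirDeriv_sub`). -/

set_option linter.unusedSectionVars false

/-! ### Shears and change of variables. -/

section Shear

variable {E : Type*} [NormedAddCommGroup E] [NormedSpace ℝ E]

/-- The affine map `x ↦ x + l x • w`. -/
noncomputable def shear (l : E →ᵃ[ℝ] ℝ) (w : E) : E →ᵃ[ℝ] E :=
  AffineMap.id ℝ E + (LinearMap.toSpanSingleton ℝ E w).toAffineMap.comp l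

@[simp] lemma shear_apply (l : E →ᵃ[ℝ] ℝ) (w x : E) : shear l w x = x + l x • w := by
  simp [shear]

lemma shear_linear (l : E →ᵃ[ℝ] ℝ) (w : E) :
    (shear l w).linear = LinearMap.transvection l.linear w := by
  ext x
  simp [shear, LinearMap.transvection.apply]

lemma shear_injective {l : E →ᵃ[ℝ] ℝ} {w : E} (h : 1 + l.linear w ≠ 0) :
    Function.Injective (shear l w) := by
  intro x y hxy
  simp only [shear_apply] at hxy
  have h1 : l x - l y = l.linear (x - y) := by
    simpa using (l.linearMap_vsub x y).symm
  have h2 : x - y = -(l x - l y) • w := by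
    have : x - y = l y • w - l x • w := by
      rw [sub_eq_sub_iff_add_eq_add, hxy, add_comm]
    rw [this]; module
  have h3 : (l x - l y) * (1 + l.linear w) = 0 := by
    have := congrArg l.linear h2
    rw [← h1, map_smul, smul_eq_mul] at this
    linarith
  have h4 : l x - l y = 0 := (mul_eq_zero.1 h3).resolve_right h
  rw [h4] at h2
  simpa [sub_eq_zero] using h2

variable [FiniteDimensional ℝ E]

lemma shear_hasFDerivAt (l : E →ᵃ[ℝ] ℝ) (w x : E) :
    HasFDerivAt (shear l w) (LinearMap.toContinuousLinearMap (shear l w).linear) x := by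
  have := ((LinearMap.toContinuousLinearMap (shear l w).linear).hasFDerivAt (x := x)).add_const
    (shear l w 0)
  refine this.congr_of_eventuallyEq (Eventually.of_forall fun y => ?_)
  have := (shear l w).decomp
  exact congrFun this y

variable [MeasurableSpace E] [BorelSpace E] (μ : Measure E) [μ.IsAddHaarMeasure]

/-- The linear part is a transvection, so the Jacobian is the constant `1 + l.linear w`. -/
lemma setIntegral_image_shear {l : E →ᵃ[ℝ] ℝ} {w : E} (h : 1 + l.linear w ≠ 0) {K : Set E}
    (hK : MeasurableSet K) (g : E → ℝ) :
    ∫ x in shear l w '' K, g x ∂μ = |1 + l.linear w| * ∫ x in K, g (shear l w x) ∂μ := by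
  rw [integral_image_eq_integral_abs_det_fderiv_smul μ hK
    (fun x _ => (shear_hasFDerivAt l w x).hasFDerivWithinAt) (shear_injective h).injOn g,
    ← integral_const_mul]
  congr 1
  ext x
  rw [smul_eq_mul, LinearMap.det_toContinuousLinearMap, shear_linear, LinearMap.transvection.det]

end Shear

/-! ### Integrals of affine functions over a simplex. -/

section Simplex

variable {E : Type*} [NormedAddCommGroup E] [NormedSpace ℝ E] [FiniteDimensional ℝ E]
  {ι : Type*} [Fintype ι]

lemma AffineBasis.isCompact_convexHull (b : AffineBasis ι ℝ E) :
    IsCompact (convexHull ℝ (Set.range b)) :=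
  (Set.finite_range b).isCompact_convexHull ℝ

lemma AffineBasis.mem_convexHull (b : AffineBasis ι ℝ E) {x : E} :
    x ∈ convexHull ℝ (Set.range b) ↔ ∀ i, 0 ≤ b.coord i x := by
  rw [b.convexHull_eq_nonneg_coord]; rfl

lemma AffineBasis.affineMap_eq_sum (b : AffineBasis ι ℝ E) (f : E →ᵃ[ℝ] ℝ) (x : E) :
    f x = ∑ i, b.coord i x * f (b i) := by
  conv_lhs => rw [← b.affineCombination_coord_eq_self x]
  rw [Finset.map_affineCombination _ _ _ (b.sum_coord_apply_eq_one x),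
    Finset.affineCombination_eq_linear_combination _ _ _ (b.sum_coord_apply_eq_one x)]
  simp

variable [MeasurableSpace E] [BorelSpace E] (μ : Measure E) [μ.IsAddHaarMeasure]

lemma Continuous.integrableOn_simplex {b : AffineBasis ι ℝ E} {g : E → ℝ} (hg : Continuous g) :
    IntegrableOn g (convexHull ℝ (Set.range b)) μ :=
  hg.continuousOn.integrableOn_compact b.isCompact_convexHull

lemma AffineBasis.measure_convexHull_pos (b : AffineBasis ι ℝ E) :
    0 < μ.real (convexHull ℝ (Set.range b)) := by
  refine ENNReal.toReal_pos (Measure.measure_pos_of_nonempty_interior μ ?_).ne'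
    b.isCompact_convexHull.measure_lt_top.ne
  exact interior_convexHull_nonempty_iff_affineSpan_eq_top.2 b.tot

/-- The simplex is symmetric: the shear along `b j - b i` with `l = coord i - coord j` swaps these
two vertices and fixes the others. Its determinant is `1 - 2 = -1`, so it preserves volume, and it
carries one coordinate to the other. -/
lemma AffineBasis.setIntegral_coord_eq [DecidableEq ι] (b : AffineBasis ι ℝ E) (i j : ι) :
    ∫ x in convexHull ℝ (Set.range b), b.coord i x ∂μ =
      ∫ x in convexHull ℝ (Set.range b), b.coord j x ∂μ := by
  by_cases hij : i = j
  · rw [hij]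
  set l : E →ᵃ[ℝ] ℝ := b.coord i - b.coord j with hl
  set w : E := b j - b i with hw
  have hlw : l.linear w = -2 := by
    have : l.linear w = l (b j) - l (b i) := l.linearMap_vsub (b j) (b i)
    rw [this]
    simp [hl, hij, Ne.symm hij]; norm_num
  have himg : shear l w '' convexHull ℝ (Set.range b) = convexHull ℝ (Set.range b) := by
    rw [AffineMap.image_convexHull]
    congr 1
    rw [← Set.range_comp]
    have : (shear l w ∘ b : ι → E) = b ∘ Equiv.swap i j := by
      ext k
      simp only [Function.comp, shear_apply, hl, hw]
      by_cases hki : k = i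
      · subst hki; simp [b.coord_apply_ne (Ne.symm hij)]
      · by_cases hkj : k = j
        · subst hkj; simp [b.coord_apply_ne hij]
        · simp [Ne.symm hki, Ne.symm hkj, Equiv.swap_apply_of_ne_of_ne hki hkj]
    rw [this, (Equiv.swap i j).surjective.range_comp]
  have h := setIntegral_image_shear μ (l := l) (w := w) (by rw [hlw]; norm_num)
    b.isCompact_convexHull.measurableSet (b.coord i)
  rw [himg, hlw] at h
  rw [h]
  norm_num
  congr 1
  ext x
  have : b.coord i (shear l w x) = b.coord i x + l x * (b.coord i).linear w := by
    rw [shear_apply, add_comm, ← vadd_eq_add, AffineMap.map_vadd]; simp [add_comm]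
  have h2 : (b.coord i).linear w = -1 := by
    have : (b.coord i).linear w = b.coord i (b j) - b.coord i (b i) := by
      exact (b.coord i).linearMap_vsub (b j) (b i)
    rw [this, b.coord_apply_eq, b.coord_apply_ne hij]; norm_num
  rw [← shear_apply, this, h2]; simp [hl]

/-- The coordinates have equal integrals and sum to `1`. -/
lemma AffineBasis.setIntegral_coord (b : AffineBasis ι ℝ E) (i : ι) :
    ∫ x in convexHull ℝ (Set.range b), b.coord i x ∂μ =
      μ.real (convexHull ℝ (Set.range b)) / Fintype.card ι := by
  classical
  have hc : ∀ j, Continuous (b.coord j) := fun j => continuous_barycentric_coord b j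
  have h : ∑ j, ∫ x in convexHull ℝ (Set.range b), b.coord j x ∂μ =
      μ.real (convexHull ℝ (Set.range b)) := by
    rw [← integral_finsetSum _ fun j _ => Continuous.integrableOn_simplex μ (hc j)]
    simp [b.sum_coord_apply_eq_one]
  rw [Finset.sum_congr rfl fun j _ => b.setIntegral_coord_eq μ j i] at h
  have hne : (Fintype.card ι : ℝ) ≠ 0 := by
    have := Fintype.card_pos_iff.2 (⟨i⟩ : Nonempty ι)
    positivity
  rw [eq_div_iff hne, ← h]; simp [mul_comm]

lemma AffineBasis.setIntegral_affineMap (b : AffineBasis ι ℝ E) (f : E →ᵃ[ℝ] ℝ) :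
    ∫ x in convexHull ℝ (Set.range b), f x ∂μ =
      μ.real (convexHull ℝ (Set.range b)) / Fintype.card ι * ∑ i, f (b i) := by
  have hc : ∀ j, Continuous (b.coord j) := fun j => continuous_barycentric_coord b j
  rw [integral_congr_ae (ae_of_all _ fun x => b.affineMap_eq_sum f x), integral_finsetSum (f := fun j x => b.coord j x * f (b j)) _ fun j _ =>
    Continuous.integrableOn_simplex μ ((hc j).mul continuous_const)]
  simp_rw [integral_mul_const, b.setIntegral_coord μ, Finset.mul_sum]

end Simplex

/-! ### The flux through the face opposite to a vertex. -/

section ConeFlux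

variable {E : Type*} [NormedAddCommGroup E] [NormedSpace ℝ E] [FiniteDimensional ℝ E]
  {ι : Type*} [Fintype ι] [MeasurableSpace E] [BorelSpace E] (μ : Measure E)
  [μ.IsAddHaarMeasure]

/-- The integral over `K` of the divergence of `x ↦ g x • (x - p)`. If `K` is a simplex with
vertex `p`, this is the flux of that field through the face opposite to `p`. -/
noncomputable def coneFlux (K : Set E) (p : E) (g : E → ℝ) : ℝ :=
  ∫ x in K, (fderiv ℝ g x (x - p) + Module.finrank ℝ E * g x) ∂μ

lemma ContDiff.continuous_fderiv_apply_of_continuous {g : E → ℝ} (hg : ContDiff ℝ 1 g) {u : E → E}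
    (hu : Continuous u) : Continuous fun x => fderiv ℝ g x (u x) :=
  (hg.continuous_fderiv one_ne_zero).clm_apply hu

lemma coneFlux_sub {K : Set E} (hK : IsCompact K) (p : E) {g₁ g₂ : E → ℝ}
    (h₁ : ContDiff ℝ 1 g₁) (h₂ : ContDiff ℝ 1 g₂) :
    coneFlux μ K p (fun x => g₁ x - g₂ x) = coneFlux μ K p g₁ - coneFlux μ K p g₂ := by
  have hi : ∀ {g : E → ℝ}, ContDiff ℝ 1 g → IntegrableOn
      (fun x => fderiv ℝ g x (x - p) + Module.finrank ℝ E * g x) K μ := fun hg =>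
    ((hg.continuous_fderiv_apply_of_continuous (by fun_prop)).add
      (hg.continuous.const_mul _)).continuousOn.integrableOn_compact hK
  unfold coneFlux
  rw [← integral_sub (hi h₁) (hi h₂)]
  congr 1
  ext x
  rw [fderiv_fun_sub (h₁.differentiable one_ne_zero x) (h₂.differentiable one_ne_zero x)]
  simp
  ring

/-- With `n + 1` vertices the integrand is `(n + 1) f x - f (b i)`; the first term integrates to the
full vertex sum and the second removes the vertex `b i`. -/
lemma coneFlux_affine (b : AffineBasis ι ℝ E) (i : ι) [DecidableEq ι] (f : E →ᵃ[ℝ] ℝ) :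
    coneFlux μ (convexHull ℝ (Set.range b)) (b i) f =
      μ.real (convexHull ℝ (Set.range b)) * ∑ j ∈ Finset.univ.erase i, f (b j) := by
  have hf : ∀ x, HasFDerivAt f (LinearMap.toContinuousLinearMap f.linear) x := fun x => by
    have := ((LinearMap.toContinuousLinearMap f.linear).hasFDerivAt (x := x)).add_const (f 0)
    exact this.congr_of_eventuallyEq (Eventually.of_forall fun y => congrFun f.decomp y)
  have hfc : Continuous f := f.continuous_of_finiteDimensional
  have hcard : (Fintype.card ι : ℝ) = Module.finrank ℝ E + 1 := by
    exact_mod_cast b.card_eq_finrank_add_one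
  have h : ∀ x, fderiv ℝ f x (x - b i) + Module.finrank ℝ E * f x =
      Fintype.card ι * f x - f (b i) := fun x => by
    rw [(hf x).fderiv, LinearMap.coe_toContinuousLinearMap', hcard]
    have : f.linear (x - b i) = f x - f (b i) := f.linearMap_vsub x (b i)
    rw [this]; ring
  unfold coneFlux
  simp_rw [h]
  have hne : (Fintype.card ι : ℝ) ≠ 0 := by rw [hcard]; positivity
  rw [integral_sub (Continuous.integrableOn_simplex μ (hfc.const_mul _))
    (Continuous.integrableOn_simplex μ continuous_const), integral_const_mul,
    b.setIntegral_affineMap μ, ← Finset.add_sum_erase _ _ (Finset.mem_univ i)]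
  simp only [integral_const, smul_eq_mul, measureReal_restrict_apply_univ]
  field_simp
  ring

/-- An affine map carries the radial field from `p` to the radial field from the image of `p`, so
only the Jacobian appears. -/
lemma coneFlux_image_shear {l : E →ᵃ[ℝ] ℝ} {w : E} (h : 1 + l.linear w ≠ 0) {K : Set E}
    (hK : MeasurableSet K) (p : E) {g : E → ℝ} (hg : ContDiff ℝ 1 g) :
    coneFlux μ (shear l w '' K) (shear l w p) g =
      |1 + l.linear w| * coneFlux μ K p (fun x => g (shear l w x)) := by
  unfold coneFlux
  rw [setIntegral_image_shear μ h hK]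
  congr 2
  ext x
  have h1 : HasFDerivAt (fun x => g (shear l w x)) _ x :=
    HasFDerivAt.comp x (hg.differentiable one_ne_zero (shear l w x)).hasFDerivAt
      (shear_hasFDerivAt l w x)
  rw [h1.fderiv]
  simp only [ContinuousLinearMap.comp_apply, LinearMap.coe_toContinuousLinearMap']
  congr 2
  exact ((shear l w).linearMap_vsub x p).symm

/-- The dilated integral `∫_{p + s(K - p)} g`. -/
noncomputable def dilatedIntegral (K : Set E) (p : E) (g : E → ℝ) (s : ℝ) : ℝ :=
  s ^ Module.finrank ℝ E * ∫ x in K, g (p + s • (x - p)) ∂μ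

/-- This expresses the flux as the rate of change of the integral of `g` under dilation about `p`.
After pulling back to the fixed set `K`, the factor `s ^ n` contributes `n g` and the integrand
contributes the radial derivative. -/
lemma hasDerivAt_dilatedIntegral {K : Set E} (hK : IsCompact K) (p : E) {g : E → ℝ}
    (hg : ContDiff ℝ 1 g) :
    HasDerivAt (dilatedIntegral μ K p g) (coneFlux μ K p g) 1 := by
  have hgc := hg.continuous
  have hc : Continuous fun z : ℝ × E => fderiv ℝ g (p + z.1 • (z.2 - p)) (z.2 - p) :=
    ((hg.continuous_fderiv one_ne_zero).comp (by fun_prop)).clm_apply (by fun_prop)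
  obtain ⟨C, hC⟩ := ((isCompact_Icc (a := (0 : ℝ)) (b := 2)).prod hK).exists_bound_of_continuousOn
    hc.continuousOn
  have h := (hasDerivAt_integral_of_dominated_loc_of_deriv_le (μ := μ.restrict K)
    (F := fun (s : ℝ) x => g (p + s • (x - p)))
    (F' := fun s x => fderiv ℝ g (p + s • (x - p)) (x - p)) (x₀ := 1) (s := Set.Icc 0 2)
    (bound := fun _ => C)
    (Icc_mem_nhds (by norm_num) (by norm_num))
    (Eventually.of_forall fun s => Continuous.aestronglyMeasurable (by fun_prop))
    (Continuous.continuousOn (by fun_prop) |>.integrableOn_compact hK)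
    (Continuous.aestronglyMeasurable
      (((hg.continuous_fderiv one_ne_zero).comp (by fun_prop)).clm_apply (by fun_prop)))
    ((ae_restrict_iff' hK.measurableSet).2 (ae_of_all _ fun x hx s hs => hC (s, x) ⟨hs, hx⟩))
    (continuousOn_const.integrableOn_compact hK)
    (ae_of_all _ fun x s _ => by
      have h1 : HasDerivAt (fun s : ℝ => p + s • (x - p)) (x - p) s := by
        simpa using ((hasDerivAt_id s).smul_const (x - p)).const_add p
      exact (hg.differentiable one_ne_zero _).hasFDerivAt.comp_hasDerivAt s h1)).2
  have h2 := (hasDerivAt_pow (Module.finrank ℝ E) (1 : ℝ)).mul h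
  refine h2.congr_deriv ?_
  simp only [one_pow, one_mul, mul_one, one_smul, add_sub_cancel]
  unfold coneFlux
  rw [integral_add, integral_const_mul, add_comm]
  · exact (hg.continuous_fderiv_apply_of_continuous (by fun_prop)).continuousOn.integrableOn_compact hK
  · exact (hgc.const_mul _).continuousOn.integrableOn_compact hK

lemma dilatedIntegral_eq {K : Set E} (hK : MeasurableSet K) (p : E) (g : E → ℝ) {s : ℝ}
    (hs : 0 < s) :
    dilatedIntegral μ K p g s = ∫ x in (fun x => p + s • (x - p)) '' K, g x ∂μ := by
  have hd : ∀ x, HasFDerivAt (fun x => p + s • (x - p)) (s • ContinuousLinearMap.id ℝ E) x :=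
    fun x => (((hasFDerivAt_id x).sub_const p).const_smul s).const_add p
  have hinj : Function.Injective (fun x => p + s • (x - p)) := fun x y h => by
    simpa [hs.ne'] using h
  rw [integral_image_eq_integral_abs_det_fderiv_smul μ hK
    (fun x _ => (hd x).hasFDerivWithinAt) hinj.injOn g, dilatedIntegral, ← integral_const_mul]
  congr 1
  ext x
  have : (s • ContinuousLinearMap.id ℝ E).det = s ^ Module.finrank ℝ E := by
    simp [ContinuousLinearMap.det]
  rw [this, abs_of_pos (by positivity), smul_eq_mul]

lemma AffineBasis.exists_abs_le_mul_coord (b : AffineBasis ι ℝ E) (i : ι) {g : E → ℝ}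
    (hg : ContDiff ℝ 1 g)
    (h0 : ∀ x ∈ convexHull ℝ (Set.range b), b.coord i x = 0 → g x = 0) :
    ∃ C, 0 ≤ C ∧ ∀ x ∈ convexHull ℝ (Set.range b), |g x| ≤ C * b.coord i x := by
  classical
  set K := convexHull ℝ (Set.range b) with hK
  have hKc : IsCompact K := b.isCompact_convexHull
  obtain ⟨B, hB⟩ := hKc.exists_bound_of_continuousOn hg.continuous.continuousOn
  obtain ⟨M, hM⟩ := hKc.exists_bound_of_continuousOn (hg.continuous_fderiv one_ne_zero).continuousOn
  obtain ⟨R, hR⟩ := hKc.exists_bound_of_continuousOn (continuous_id.sub (continuous_const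
    (y := b i))).continuousOn
  have hbi : b i ∈ K := subset_convexHull ℝ _ ⟨i, rfl⟩
  have hM0 : 0 ≤ M := (norm_nonneg _).trans (hM _ hbi)
  have hR0 : 0 ≤ R := (norm_nonneg _).trans (hR _ hbi)
  have hB0 : 0 ≤ B := (norm_nonneg _).trans (hB _ hbi)
  refine ⟨B + M * R, by positivity, fun x hx => ?_⟩
  have hxc := b.mem_convexHull.1 hx
  set t := b.coord i x with ht
  have ht0 : 0 ≤ t := hxc i
  have ht1 : t ≤ 1 := by
    rw [← b.sum_coord_apply_eq_one x]
    exact Finset.single_le_sum (f := fun j => b.coord j x) (fun j _ => hxc j) (Finset.mem_univ i)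
  -- At the vertex itself (`t = 1`) the projection below is undefined, and the supremum bound `B`
  -- suffices.
  rcases ht1.eq_or_lt with h1 | h1
  · rw [h1, mul_one]
    have := hB x hx
    rw [Real.norm_eq_abs] at this
    nlinarith
  have hpos : 0 < 1 - t := by linarith
  -- The projection of `x` from `b i` onto the opposite face, where `g` vanishes; the mean value
  -- inequality is applied between `y` and `x`.
  set y : E := AffineMap.lineMap (b i) x (1 - t)⁻¹ with hy
  have hyj : ∀ j, b.coord j y = b.coord j (b i) + (1 - t)⁻¹ * (t * 0 + (b.coord j x - b.coord j (b i))) := by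
    intro j
    rw [hy, AffineMap.apply_lineMap, AffineMap.lineMap_apply]
    simp; ring
  have hyi : b.coord i y = 0 := by
    rw [hyj, b.coord_apply_eq, ← ht]; field_simp; ring
  have hyK : y ∈ K := b.mem_convexHull.2 fun j => by
    by_cases hji : j = i
    · rw [hji, hyi]
    · rw [hyj, b.coord_apply_ne hji]
      have := hxc j
      simp; positivity
  have hxy : x - y = -t • (y - b i) := by
    have : y - b i = (1 - t)⁻¹ • (x - b i) := by
      rw [hy, AffineMap.lineMap_apply]; simp
    have h2 : x - b i = (1 - t) • (y - b i) := by
      rw [this, smul_smul, mul_inv_cancel₀ hpos.ne', one_smul]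
    have h3 : x - y = (x - b i) - (y - b i) := by abel
    rw [h3, h2]; module
  have hle := (convex_convexHull ℝ (Set.range b)).norm_image_sub_le_of_norm_fderiv_le
    (fun z _ => hg.differentiable one_ne_zero z) hM hyK hx
  rw [h0 y hyK hyi, sub_zero, hxy, Real.norm_eq_abs, norm_smul, norm_neg, Real.norm_eq_abs,
    abs_of_nonneg ht0] at hle
  have h4 : ‖y - b i‖ ≤ R := hR y hyK
  calc |g x| ≤ M * (t * ‖y - b i‖) := hle
    _ ≤ M * (t * R) := by gcongr
    _ ≤ (B + M * R) * t := by nlinarith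

/-- Shrinking the simplex towards `b i` by a factor `s` removes a layer of volume `O(1 - s)` next to
the opposite face. There `g` is `O(1 - s)`, so the integral changes by `O((1 - s) ^ 2)` and its
derivative at `s = 1`, the flux, is zero. -/
lemma coneFlux_eq_zero (b : AffineBasis ι ℝ E) (i : ι) {g : E → ℝ} (hg : ContDiff ℝ 1 g)
    (h0 : ∀ x ∈ convexHull ℝ (Set.range b), b.coord i x = 0 → g x = 0) :
    coneFlux μ (convexHull ℝ (Set.range b)) (b i) g = 0 := by
  obtain ⟨C, hC0, hC⟩ := b.exists_abs_le_mul_coord i hg h0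
  set K := convexHull ℝ (Set.range b) with hK
  set n := Module.finrank ℝ E
  have hKc : IsCompact K := b.isCompact_convexHull
  have hKm := hKc.measurableSet
  have hbi : b i ∈ K := subset_convexHull ℝ _ ⟨i, rfl⟩
  have hgi : IntegrableOn g K μ := hg.continuous.continuousOn.integrableOn_compact hKc
  have key : ∀ s ∈ Set.Ioo (0 : ℝ) 1,
      |dilatedIntegral μ K (b i) g 1 - dilatedIntegral μ K (b i) g s| ≤
        C * (1 - s) * (n * (1 - s) * μ.real K) := by
    rintro s ⟨hs0, hs1⟩
    set f : E → E := fun x => b i + s • (x - b i) with hf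
    have hfK : f '' K ⊆ K := by
      rintro _ ⟨x, hx, rfl⟩
      have := (convex_convexHull ℝ (Set.range b)).lineMap_mem hbi hx ⟨hs0.le, hs1.le⟩
      rwa [AffineMap.lineMap_apply, vadd_eq_add, vsub_eq_sub, add_comm] at this
    have hfm : MeasurableSet (f '' K) := (hKc.image (by fun_prop)).measurableSet
    have h1 : dilatedIntegral μ K (b i) g 1 = ∫ x in K, g x ∂μ := by simp [dilatedIntegral]
    have hvol : μ.real (K \ f '' K) = (1 - s ^ n) * μ.real K := by
      rw [measureReal_sdiff hfK hfm hKc.measure_lt_top.ne]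
      have : f '' K = AffineMap.homothety (b i) s '' K := by
        congr 1; ext x; simp [hf, AffineMap.homothety_apply, add_comm]
      rw [this, measureReal_def μ (_ '' _), Measure.addHaar_image_homothety, ENNReal.toReal_mul,
        ENNReal.toReal_ofReal (abs_nonneg _), abs_of_pos (by positivity), ← measureReal_def]
      ring
    rw [h1, dilatedIntegral_eq μ hKm _ _ hs0, ← setIntegral_sdiff hfm hgi hfK, ← Real.norm_eq_abs]
    refine (norm_setIntegral_le_of_norm_le_const (C := C * (1 - s)) ?_ ?_).trans ?_
    · exact (measure_mono Set.sdiff_subset).trans_lt hKc.measure_lt_top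
    · rintro x ⟨hxK, hxf⟩
      refine (hC x hxK).trans (mul_le_mul_of_nonneg_left ?_ hC0)
      -- A point of `K` whose `i`-th coordinate exceeds `1 - s` has its preimage under the dilation
      -- in `K`, so it is not in the removed layer.
      by_contra! hlt
      refine hxf ⟨AffineMap.lineMap (b i) x s⁻¹, b.mem_convexHull.2 fun j => ?_, ?_⟩
      · rw [AffineMap.apply_lineMap, AffineMap.lineMap_apply]
        have hxj := b.mem_convexHull.1 hxK j
        by_cases hji : j = i
        · subst hji
          simp only [b.coord_apply_eq, vsub_eq_sub, smul_eq_mul, vadd_eq_add]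
          have : s⁻¹ * (b.coord j x - 1) + 1 = s⁻¹ * (b.coord j x - (1 - s)) := by
            field_simp; ring
          rw [this]
          exact mul_nonneg (by positivity) (by linarith)
        · simp only [b.coord_apply_ne hji, vsub_eq_sub, smul_eq_mul, vadd_eq_add]
          simp; positivity
      · simp [hf, AffineMap.lineMap_apply, smul_smul, mul_inv_cancel₀ hs0.ne']
    · rw [hvol]
      -- Bernoulli's inequality bounds the volume `1 - s ^ n` of the layer linearly in `1 - s`.
      have hb := one_add_mul_le_pow (a := s - 1) (by linarith) n
      have h3 : 1 - s ^ n ≤ n * (1 - s) := by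
        have : 1 + (s - 1) = s := by ring
        rw [this] at hb; linarith
      have : 0 ≤ C * (1 - s) := mul_nonneg hC0 (by linarith)
      gcongr
  have hd := hasDerivAt_iff_tendsto_slope.1 (hasDerivAt_dilatedIntegral μ hKc (b i) hg)
  have hd' : Tendsto (slope (dilatedIntegral μ K (b i) g) 1) (𝓝[<] 1)
      (𝓝 (coneFlux μ K (b i) g)) :=
    hd.mono_left (nhdsWithin_mono _ fun x hx => (ne_of_lt hx : x ≠ 1))
  refine tendsto_nhds_unique hd' (squeeze_zero_norm' (a := fun s => C * n * μ.real K * (1 - s)) ?_ ?_)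
  · filter_upwards [Ioo_mem_nhdsLT (zero_lt_one' ℝ)] with s hs
    have hs1 : 0 < 1 - s := by linarith [hs.2]
    rw [slope_comm, slope_def_field, norm_div, Real.norm_eq_abs, Real.norm_eq_abs,
      abs_of_pos hs1, div_le_iff₀ hs1]
    refine (key s hs).trans (le_of_eq (by ring))
  · have : Tendsto (fun s : ℝ => C * n * μ.real K * (1 - s)) (𝓝 1)
        (𝓝 (C * n * μ.real K * (1 - 1))) := Continuous.tendsto (by fun_prop) 1
    simpa using this.mono_left nhdsWithin_le_nhds

lemma integral_affineField_eq_sum_coneFlux (b : AffineBasis ι ℝ E) {K : Set E} (hK : IsCompact K)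
    {g : E → ℝ} (hg : ContDiff ℝ 1 g) (c : ι → ℝ) :
    ∫ x in K, (fderiv ℝ g x (∑ i, c i • (x - b i)) +
      (Module.finrank ℝ E * ∑ i, c i) * g x) ∂μ = ∑ i, c i * coneFlux μ K (b i) g := by
  simp_rw [coneFlux, ← integral_const_mul]
  rw [← integral_finsetSum]
  · congr 1
    ext x
    simp only [map_sum, map_smul, smul_eq_mul, mul_add, Finset.sum_add_distrib, Finset.mul_sum,
      Finset.sum_mul]
    congr 1
    exact Finset.sum_congr rfl fun i _ => by ring
  · intro i _
    exact ((hg.continuous_fderiv_apply_of_continuous (by fun_prop)).add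
      (hg.continuous.const_mul _)).const_mul (c i) |>.continuousOn.integrableOn_compact hK

/-- Every field `x ↦ a + β • x` is a combination of the fields `x ↦ x - b i`. -/
lemma AffineBasis.exists_affineField_eq (b : AffineBasis ι ℝ E) (a : E) (β : ℝ) :
    ∃ c : ι → ℝ, ∑ i, c i = β ∧ ∀ x, ∑ i, c i • (x - b i) = a + β • x := by
  -- Coordinates of a point sum to `1` and reproduce the point. Hence these coefficients sum to `1 +
  -- (β - 1)`, and weighting the vertices by them gives `-a + (β - 1) • 0`.
  refine ⟨fun i => b.coord i (-a) + (β - 1) * b.coord i 0, ?_, fun x => ?_⟩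
  · rw [Finset.sum_add_distrib, ← Finset.mul_sum, b.sum_coord_apply_eq_one,
      b.sum_coord_apply_eq_one]; ring
  · simp only [smul_sub, Finset.sum_sub_distrib, ← Finset.sum_smul]
    rw [Finset.sum_add_distrib, ← Finset.mul_sum, b.sum_coord_apply_eq_one,
      b.sum_coord_apply_eq_one]
    simp only [add_smul, mul_smul, Finset.sum_add_distrib, ← Finset.smul_sum,
      b.linear_combination_coord_eq_self]
    module

end ConeFlux

/-! ### Combinatorics and geometry of the mesh. -/

section Mesh

variable {d : ℕ} {Ω : Set (EuclideanSpace ℝ (Fin d))}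
  {𝒯 : Finset (Finset (EuclideanSpace ℝ (Fin d)))}

/-- The vertices of an element of a mesh, as an affine basis. -/
noncomputable def IsConformingMesh.basis (h : IsConformingMesh Ω 𝒯)
    {T : Finset (EuclideanSpace ℝ (Fin d))} (hT : T ∈ 𝒯) :
    AffineBasis T ℝ (EuclideanSpace ℝ (Fin d)) where
  toFun := (↑)
  ind' := h.affineIndependent T hT
  tot' := by
    rw [(h.affineIndependent T hT).affineSpan_eq_top_iff_card_eq_finrank_add_one]
    simp [h.card_eq T hT]

/-- The barycentric coordinate of the vertex `p` of the element `T`. -/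
noncomputable def IsConformingMesh.coord (h : IsConformingMesh Ω 𝒯)
    {T : Finset (EuclideanSpace ℝ (Fin d))} (hT : T ∈ 𝒯) {p : EuclideanSpace ℝ (Fin d)}
    (hp : p ∈ T) : EuclideanSpace ℝ (Fin d) →ᵃ[ℝ] ℝ :=
  (h.basis hT).coord ⟨p, hp⟩

variable {T T' : Finset (EuclideanSpace ℝ (Fin d))} {p p' q x : EuclideanSpace ℝ (Fin d)}

namespace IsConformingMesh

@[simp] lemma basis_apply
    (h : IsConformingMesh Ω 𝒯) (hT : T ∈ 𝒯) (q : T) : h.basis hT q = q := rfl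

lemma range_basis
    (h : IsConformingMesh Ω 𝒯) (hT : T ∈ 𝒯) : Set.range (h.basis hT) = (T : Set (EuclideanSpace ℝ (Fin d))) :=
  Subtype.range_coe

lemma simplexHull_eq
    (h : IsConformingMesh Ω 𝒯) (hT : T ∈ 𝒯) : simplexHull T = convexHull ℝ (Set.range (h.basis hT)) := by
  rw [h.range_basis hT, simplexHull]

lemma coord_self
    (h : IsConformingMesh Ω 𝒯) (hT : T ∈ 𝒯) (hp : p ∈ T) : h.coord hT hp p = 1 :=
  (h.basis hT).coord_apply_eq ⟨p, hp⟩

lemma coord_of_ne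
    (h : IsConformingMesh Ω 𝒯) (hT : T ∈ 𝒯) (hp : p ∈ T) (hq : q ∈ T) (hqp : q ≠ p) : h.coord hT hp q = 0 :=
  (h.basis hT).coord_apply_ne (i := ⟨p, hp⟩) (j := ⟨q, hq⟩) fun e => hqp (congrArg Subtype.val e).symm

lemma continuous_coord
    (h : IsConformingMesh Ω 𝒯) (hT : T ∈ 𝒯) (hp : p ∈ T) : Continuous (h.coord hT hp) :=
  AffineMap.continuous_of_finiteDimensional _

lemma affineMap_ext
    (h : IsConformingMesh Ω 𝒯) (hT : T ∈ 𝒯) {f g : EuclideanSpace ℝ (Fin d) →ᵃ[ℝ] ℝ} (hfg : ∀ q ∈ T, f q = g q) (x) :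
    f x = g x := by
  rw [(h.basis hT).affineMap_eq_sum f x, (h.basis hT).affineMap_eq_sum g x]
  exact Finset.sum_congr rfl fun q _ => by rw [basis_apply, hfg q q.2]

lemma mem_simplexHull_iff
    (h : IsConformingMesh Ω 𝒯) (hT : T ∈ 𝒯) : x ∈ simplexHull T ↔ ∀ q (hq : q ∈ T), 0 ≤ h.coord hT hq x := by
  rw [h.simplexHull_eq hT, AffineBasis.mem_convexHull, Subtype.forall]; rfl

lemma mem_interior_iff
    (h : IsConformingMesh Ω 𝒯) (hT : T ∈ 𝒯) : x ∈ interior (simplexHull T) ↔ ∀ q (hq : q ∈ T), 0 < h.coord hT hq x := by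
  rw [h.simplexHull_eq hT, AffineBasis.interior_convexHull, Set.mem_ofPred_eq, Subtype.forall]; rfl

/-- Conformity enters the proof here: a common point lies in the hull of the common vertices, and at
each of those the coordinate of `p` is zero. -/
lemma coord_eq_zero_of_mem
    (h : IsConformingMesh Ω 𝒯) (hT : T ∈ 𝒯) (hT' : T' ∈ 𝒯) (hx : x ∈ simplexHull T) (hx' : x ∈ simplexHull T') (hp : p ∈ T)
    (hp' : p ∉ T') : h.coord hT hp x = 0 := by
  have hxx : x ∈ convexHull ℝ ((T : Set (EuclideanSpace ℝ (Fin d))) ∩ T') := by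
    rw [← h.conforming T hT T' hT']; exact ⟨hx, hx'⟩
  have hsub : convexHull ℝ ((T : Set (EuclideanSpace ℝ (Fin d))) ∩ T') ⊆
      h.coord hT hp ⁻¹' {0} := by
    refine convexHull_min ?_ ((convex_singleton (0 : ℝ)).affine_preimage _)
    rintro q ⟨hq, hq'⟩
    exact h.coord_of_ne hT hp hq fun e => hp' (e ▸ hq')
  exact hsub hxx

lemma exists_mem_notMem
    (h : IsConformingMesh Ω 𝒯) (hT : T ∈ 𝒯) (hT' : T' ∈ 𝒯) (hne : T ≠ T') : ∃ p ∈ T, p ∉ T' := by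
  by_contra! hsub
  exact hne (Finset.eq_of_subset_of_card_le hsub (by rw [h.card_eq T hT, h.card_eq T' hT']))

lemma disjoint_interior
    (h : IsConformingMesh Ω 𝒯) (hT : T ∈ 𝒯) (hT' : T' ∈ 𝒯) (hne : T ≠ T') :
    Disjoint (interior (simplexHull T)) (interior (simplexHull T')) := by
  rw [Set.disjoint_left]
  intro x hx hx'
  obtain ⟨p, hp, hp'⟩ := h.exists_mem_notMem hT hT' hne
  exact ((h.mem_interior_iff hT).1 hx p hp).ne'
    (h.coord_eq_zero_of_mem hT hT' (interior_subset hx) (interior_subset hx') hp hp')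

lemma isCompact_simplexHull : IsCompact (simplexHull T) :=
  T.finite_toSet.isCompact_convexHull ℝ

variable [DecidableEq (EuclideanSpace ℝ (Fin d))]

lemma mem_simplexHull_erase_iff
    (h : IsConformingMesh Ω 𝒯) (hT : T ∈ 𝒯) (hp : p ∈ T) :
    x ∈ simplexHull (T.erase p) ↔ x ∈ simplexHull T ∧ h.coord hT hp x = 0 := by
  constructor
  · intro hx
    refine ⟨convexHull_mono (by simp) hx, ?_⟩
    have hsub : simplexHull (T.erase p) ⊆ h.coord hT hp ⁻¹' {0} := by
      refine convexHull_min ?_ ((convex_singleton (0 : ℝ)).affine_preimage _)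
      intro q hq
      have hq := Finset.mem_erase.1 (Finset.mem_coe.1 hq)
      exact h.coord_of_ne hT hp hq.2 hq.1
    exact hsub hx
  · rintro ⟨hx, hx0⟩
    have hc := (h.mem_simplexHull_iff hT).1 hx
    have hs := (h.basis hT).linear_combination_coord_eq_self x
    have h1 := (h.basis hT).sum_coord_apply_eq_one x
    rw [← Finset.add_sum_erase _ _ (Finset.mem_univ (⟨p, hp⟩ : T))] at hs h1
    have h0 : (h.basis hT).coord ⟨p, hp⟩ x = 0 := hx0
    rw [h0, zero_smul, zero_add] at hs
    rw [h0, zero_add] at h1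
    rw [← hs]
    refine (convex_convexHull ℝ _).sum_mem (fun q _ => hc q q.2) h1 fun q hq => ?_
    refine subset_convexHull ℝ _ ?_
    simp only [Finset.coe_erase, basis_apply]
    exact ⟨q.2, fun e => (Finset.mem_erase.1 hq).1 (Subtype.ext e)⟩

/-- A point of the face of `T` opposite to `p` which is not on a smaller face. -/
lemma exists_forall_coord_pos
    (h : IsConformingMesh Ω 𝒯) (hT : T ∈ 𝒯) (hd : 1 ≤ d) (hp : p ∈ T) : ∃ y ∈ simplexHull (T.erase p),
    h.coord hT hp y = 0 ∧ ∀ q (hq : q ∈ T), q ≠ p → 0 < h.coord hT hq y := by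
  have hcard : (T.erase p).card = d := by rw [Finset.card_erase_of_mem hp, h.card_eq T hT]; rfl
  have hd0 : (0 : ℝ) < d := by exact_mod_cast hd
  -- The barycentre of the face, which has exactly `d` vertices.
  set y : EuclideanSpace ℝ (Fin d) := ∑ q ∈ T.erase p, (d : ℝ)⁻¹ • q with hy
  have hy1 : ∑ q ∈ T.erase p, (d : ℝ)⁻¹ = 1 := by
    rw [Finset.sum_const, hcard, nsmul_eq_mul, mul_inv_cancel₀ hd0.ne']
  have hyF : y ∈ simplexHull (T.erase p) :=
    (convex_convexHull ℝ _).sum_mem (fun _ _ => by positivity) hy1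
      fun q hq => subset_convexHull ℝ _ hq
  have hval : ∀ f : EuclideanSpace ℝ (Fin d) →ᵃ[ℝ] ℝ, f y = ∑ q ∈ T.erase p, (d : ℝ)⁻¹ * f q := by
    intro f
    rw [hy, ← Finset.affineCombination_eq_linear_combination _ _ _ hy1,
      Finset.map_affineCombination _ _ _ hy1,
      Finset.affineCombination_eq_linear_combination _ _ _ hy1]
    simp
  refine ⟨y, hyF, ((h.mem_simplexHull_erase_iff hT hp).1 hyF).2, fun q hq hqp => ?_⟩
  rw [hval, Finset.sum_eq_single q]
  · rw [h.coord_self]; positivity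
  · intro r hr hrq
    rw [h.coord_of_ne hT hq (Finset.mem_of_mem_erase hr) hrq, mul_zero]
  · intro hq'; exact absurd (Finset.mem_erase.2 ⟨hqp, hq⟩) hq'

/-- A face which is not contained in the boundary belongs to a second element. -/
lemma exists_neighbor
    (h : IsConformingMesh Ω 𝒯) (hT : T ∈ 𝒯) (hΩ : IsOpen Ω) (hd : 1 ≤ d) (hp : p ∈ T)
    (hF : ¬ simplexHull (T.erase p) ⊆ frontier Ω) : ∃ T' ∈ 𝒯, T' ≠ T ∧ T.erase p ⊆ T' := by
  obtain ⟨z, hzF, hz⟩ := Set.not_subset.1 hF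
  have hzT := (h.mem_simplexHull_erase_iff hT hp).1 hzF
  have hzΩ : z ∈ Ω := by
    by_contra hzΩ
    refine hz ⟨?_, by rwa [hΩ.interior_eq]⟩
    rw [← h.cover]
    exact Set.mem_biUnion hT hzT.1
  obtain ⟨y, hyF, hy0, hypos⟩ := h.exists_forall_coord_pos hT hd hp
  -- Moving `z` slightly towards the barycentre-type point `y` stays in the open set `Ω` and reaches
  -- the relative interior of the face.
  have hlim : Tendsto (fun t : ℝ => AffineMap.lineMap z y t) (𝓝[>] 0) (𝓝 z) := by
    have : Tendsto (fun t : ℝ => AffineMap.lineMap z y t) (𝓝 0) (𝓝 (AffineMap.lineMap z y (0:ℝ))) :=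
      Continuous.tendsto (by fun_prop) 0
    rw [AffineMap.lineMap_apply_zero] at this
    exact this.mono_left nhdsWithin_le_nhds
  obtain ⟨t, htΩ, ht⟩ := ((hlim.eventually (hΩ.mem_nhds hzΩ)).and (Ioo_mem_nhdsGT (zero_lt_one' ℝ))).exists
  set x := AffineMap.lineMap z y t with hx
  have hxF : x ∈ simplexHull (T.erase p) :=
    (convex_convexHull ℝ _).lineMap_mem hzF hyF ⟨ht.1.le, ht.2.le⟩
  have hxT := (h.mem_simplexHull_erase_iff hT hp).1 hxF
  have hxpos : ∀ q (hq : q ∈ T), q ≠ p → 0 < h.coord hT hq x := by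
    intro q hq hqp
    rw [hx, AffineMap.apply_lineMap, AffineMap.lineMap_apply_module]
    have h1 := (h.mem_simplexHull_iff hT).1 hzT.1 q hq
    have h2 := hypos q hq hqp
    have h3 : 0 < 1 - t := by linarith [ht.2]
    have h4 := ht.1
    simp only [smul_eq_mul]
    positivity
  -- If no other element contained `x`, then `T` alone would cover a neighbourhood of `x`, although
  -- `x` lies on a face of `T`.
  have hex : ∃ T' ∈ 𝒯, T' ≠ T ∧ x ∈ simplexHull T' := by
    by_contra! hno
    have hclosed : IsClosed (⋃ T' ∈ 𝒯.erase T, simplexHull T') :=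
      (𝒯.erase T).finite_toSet.isClosed_biUnion fun T' _ => isCompact_simplexHull.isClosed
    have hxn : x ∉ ⋃ T' ∈ 𝒯.erase T, simplexHull T' := by
      simp only [Set.mem_iUnion, not_exists]
      intro T' hT' hxT'
      exact hno T' (Finset.mem_of_mem_erase hT') (Finset.ne_of_mem_erase hT') hxT'
    have hint : x ∈ interior (simplexHull T) := by
      rw [mem_interior_iff_mem_nhds]
      filter_upwards [hΩ.mem_nhds htΩ, hclosed.isOpen_compl.mem_nhds hxn] with w hw hw'
      have : w ∈ ⋃ T ∈ 𝒯, simplexHull T := by rw [h.cover]; exact subset_closure hw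
      obtain ⟨T', hT', hwT'⟩ := Set.mem_iUnion₂.1 this
      by_cases hTT : T' = T
      · rwa [← hTT]
      · exact absurd (Set.mem_biUnion (Finset.mem_erase.2 ⟨hTT, hT'⟩) hwT') hw'
    exact ((h.mem_interior_iff hT).1 hint p hp).ne' hxT.2
  obtain ⟨T', hT', hne, hxT'⟩ := hex
  refine ⟨T', hT', hne, fun q hq => ?_⟩
  -- A vertex of the face missing from `T'` would have coordinate zero at `x`, but `x` is in the
  -- relative interior of the face.
  by_contra hq'
  have hq := Finset.mem_erase.1 hq
  exact (hxpos q hq.2 hq.1).ne' (h.coord_eq_zero_of_mem hT hT' hxT.1 hxT' hq.2 hq')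

/-- Two elements sharing a face lie on opposite sides of it. -/
lemma coord_neg_of_erase_eq
    (h : IsConformingMesh Ω 𝒯) (hT : T ∈ 𝒯) (hT' : T' ∈ 𝒯) (hd : 1 ≤ d) (hne : T ≠ T') (hp : p ∈ T) (hp' : p' ∈ T')
    (hF : T.erase p = T'.erase p') : h.coord hT hp p' < 0 := by
  have hpT' : p ∉ T' := fun hpT => hne <| by
    refine Finset.eq_of_subset_of_card_le (fun q hq => ?_) (by rw [h.card_eq T hT, h.card_eq T' hT'])
    by_cases hqp : q = p
    · rwa [hqp]
    · exact Finset.mem_of_mem_erase (hF ▸ Finset.mem_erase.2 ⟨hqp, hq⟩)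
  have hFT' : ∀ q ∈ T, q ≠ p → q ∈ T' := fun q hq hqp =>
    Finset.mem_of_mem_erase (hF ▸ Finset.mem_erase.2 ⟨hqp, hq⟩)
  by_contra! hle
  rcases hle.eq_or_lt with h0 | hpos
  -- If `p'` lay in the hyperplane of the face, the coordinate would vanish at all vertices of `T'`,
  -- hence identically, yet it equals `1` at `p`.
  · have hzero : ∀ x, h.coord hT hp x = (0 : EuclideanSpace ℝ (Fin d) →ᵃ[ℝ] ℝ) x := by
      refine h.affineMap_ext hT' fun q hq => ?_
      by_cases hqp : q = p'
      · rw [hqp, ← h0]; rfl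
      · have := Finset.mem_erase.1 (hF ▸ Finset.mem_erase.2 ⟨hqp, hq⟩ : q ∈ T.erase p)
        rw [h.coord_of_ne hT hp this.2 this.1]; rfl
    have := hzero p
    rw [h.coord_self] at this
    exact one_ne_zero this
  -- If `p'` lay on the side of `p`, the segment from `y` to `p'` would start inside both elements,
  -- at points where the coordinate of `p` is positive; conformity excludes this.
  · obtain ⟨y, hyF, hy0, hypos⟩ := h.exists_forall_coord_pos hT hd hp
    have hev : ∀ᶠ t : ℝ in 𝓝[>] 0, ∀ q : T, 0 ≤ h.coord hT q.2 (AffineMap.lineMap y p' t) := by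
      rw [eventually_all]
      rintro ⟨q, hq⟩
      by_cases hqp : q = p
      · subst hqp
        filter_upwards [self_mem_nhdsWithin] with t ht
        rw [AffineMap.apply_lineMap, hy0, AffineMap.lineMap_apply_module]
        have : (0 : ℝ) < t := ht
        simp only [smul_eq_mul, mul_zero, zero_add]
        exact (mul_pos this hpos).le
      · have hlim : Tendsto (fun t : ℝ => h.coord hT hq (AffineMap.lineMap y p' t)) (𝓝[>] 0)
            (𝓝 (h.coord hT hq y)) := by
          have hc : Continuous fun t : ℝ => h.coord hT hq (AffineMap.lineMap y p' t) :=
            (h.continuous_coord hT hq).comp (by fun_prop)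
          have := hc.tendsto 0
          rw [AffineMap.lineMap_apply_zero] at this
          exact this.mono_left nhdsWithin_le_nhds
        exact (hlim.eventually (lt_mem_nhds (hypos q hq hqp))).mono fun t ht => ht.le
    obtain ⟨t, ht, ht01⟩ := (hev.and (Ioo_mem_nhdsGT (zero_lt_one' ℝ))).exists
    have hxT : AffineMap.lineMap y p' t ∈ simplexHull T :=
      (h.mem_simplexHull_iff hT).2 fun q hq => ht ⟨q, hq⟩
    have hxT' : AffineMap.lineMap y p' t ∈ simplexHull T' := by
      refine (convex_convexHull ℝ _).lineMap_mem ?_ (subset_convexHull ℝ _ hp') ⟨ht01.1.le, ht01.2.le⟩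
      rw [hF] at hyF
      exact ((h.mem_simplexHull_erase_iff hT' hp').1 hyF).1
    have := h.coord_eq_zero_of_mem hT hT' hxT hxT' hp hpT'
    rw [AffineMap.apply_lineMap, hy0, AffineMap.lineMap_apply_module] at this
    simp [ht01.1.ne', hpos.ne'] at this

/-- At most two elements share a face. -/
lemma eq_of_erase_eq
    (h : IsConformingMesh Ω 𝒯) (hT : T ∈ 𝒯) (hT' : T' ∈ 𝒯) (hd : 1 ≤ d) {T'' : Finset (EuclideanSpace ℝ (Fin d))} (hT'' : T'' ∈ 𝒯)
    {p'' : EuclideanSpace ℝ (Fin d)} (hp : p ∈ T) (hp' : p' ∈ T') (hp'' : p'' ∈ T'')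
    (hne' : T ≠ T') (hne'' : T ≠ T'') (hF' : T.erase p = T'.erase p')
    (hF'' : T.erase p = T''.erase p'') : T' = T'' := by
  by_contra hne
  have h1 := h.coord_neg_of_erase_eq hT hT' hd hne' hp hp' hF'
  have h2 := h.coord_neg_of_erase_eq hT hT'' hd hne'' hp hp'' hF''
  have h3 := h.coord_neg_of_erase_eq hT' hT'' hd hne hp' hp'' (hF'.symm.trans hF'')
  -- Both coordinates vanish on the common face, so they are proportional. Evaluated at `p''`, a
  -- negative number would equal a product of two negative ones: three vertices cannot lie on
  -- pairwise opposite sides of a hyperplane.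
  have h4 : ∀ x, h.coord hT hp x = (h.coord hT hp p' • h.coord hT' hp') x := by
    refine h.affineMap_ext hT' fun q hq => ?_
    by_cases hqp : q = p'
    · subst hqp; simp [h.coord_self]
    · have := Finset.mem_erase.1 (hF' ▸ Finset.mem_erase.2 ⟨hqp, hq⟩ : q ∈ T.erase p)
      simp [h.coord_of_ne hT hp this.2 this.1, h.coord_of_ne hT' hp' hq hqp]
  have h5 := h4 p''
  simp only [AffineMap.coe_smul, Pi.smul_apply, smul_eq_mul] at h5
  nlinarith

/-- The shear that fixes the common face and moves `p` to `p'` maps `T` onto `T'` with determinant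
`h.coord hT hp p' < 0`. Composing `g` with it does not change `g` on the face, hence does not change
the flux. -/
lemma coneFlux_neighbor
    (h : IsConformingMesh Ω 𝒯) (hT : T ∈ 𝒯) (hT' : T' ∈ 𝒯) (hd : 1 ≤ d) (hne : T ≠ T') (hp : p ∈ T) (hp' : p' ∈ T')
    (hF : T.erase p = T'.erase p') {g : EuclideanSpace ℝ (Fin d) → ℝ} (hg : ContDiff ℝ 1 g) :
    coneFlux volume (simplexHull T') p' g =
      -h.coord hT hp p' * coneFlux volume (simplexHull T) p g := by
  have hneg := h.coord_neg_of_erase_eq hT hT' hd hne hp hp' hF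
  set l := h.coord hT hp with hl
  set w := p' - p with hw
  have hlw : 1 + l.linear w = l p' := by
    have : l.linear w = l p' - l p := l.linearMap_vsub p' p
    rw [this, hl, h.coord_self]; ring
  have hwp : shear l w p = p' := by simp [hl, h.coord_self, hw]
  have himg : shear l w '' simplexHull T = simplexHull T' := by
    rw [simplexHull, AffineMap.image_convexHull, simplexHull]
    congr 1
    rw [← Finset.insert_erase hp, ← Finset.insert_erase hp', ← hF, Finset.coe_insert,
      Finset.coe_insert, Set.image_insert_eq, hwp]
    congr 1
    refine (Set.image_congr fun q hq => ?_).trans (Set.image_id _)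
    have hq := Finset.mem_erase.1 (Finset.mem_coe.1 hq)
    simp [hl, h.coord_of_ne hT hp hq.2 hq.1]
  have hgs : ContDiff ℝ 1 fun x => g (shear l w x) := by
    refine hg.comp ?_
    have : (shear l w : EuclideanSpace ℝ (Fin d) → _) = fun x =>
      LinearMap.toContinuousLinearMap (shear l w).linear x + shear l w 0 := (shear l w).decomp
    rw [this]
    fun_prop
  have h1 := coneFlux_image_shear volume (l := l) (w := w) (by rw [hlw]; exact hneg.ne)
    (isCompact_simplexHull (T := T)).measurableSet p hg
  have h2 : coneFlux volume (simplexHull T) p (fun x => g (shear l w x) - g x) = 0 := by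
    rw [h.simplexHull_eq hT]
    refine coneFlux_eq_zero volume (h.basis hT) ⟨p, hp⟩ (hgs.sub hg) fun x _ hx0 => ?_
    have : l x = 0 := hx0
    simp [this]
  rw [coneFlux_sub volume isCompact_simplexHull p hgs hg] at h2
  rw [himg, hwp, hlw, abs_of_neg hneg] at h1
  rw [h1, sub_eq_zero.1 h2]

end IsConformingMesh

end Mesh

/-- A sum over a set on which the nonzero terms are paired with their negatives vanishes. -/
lemma Finset.sum_eq_zero_of_pairing {α : Type*} (S : Finset α) (f : α → ℝ) (R : α → α → Prop)
    (hsymm : ∀ a b, R a b → R b a) (hirr : ∀ a, ¬ R a a)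
    (hex : ∀ a ∈ S, f a ≠ 0 → ∃ b ∈ S, R a b)
    (huniq : ∀ a ∈ S, ∀ b ∈ S, ∀ c ∈ S, R a b → R a c → b = c)
    (hcancel : ∀ a ∈ S, ∀ b ∈ S, R a b → f a + f b = 0) : ∑ a ∈ S, f a = 0 := by
  classical
  rw [← Finset.sum_filter_ne_zero]
  have hex' : ∀ a, ∀ ha : a ∈ S.filter (f · ≠ 0), ∃ b ∈ S, R a b := fun a ha =>
    hex a (Finset.mem_filter.1 ha).1 (Finset.mem_filter.1 ha).2
  choose g hgS hgR using hex'
  -- A partner's term is the negative of a nonzero term, so the partner map preserves the nonzero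
  -- terms.
  have hmem : ∀ a ha, g a ha ∈ S.filter (f · ≠ 0) := by
    intro a ha
    have ha' := Finset.mem_filter.1 ha
    have := hcancel a ha'.1 _ (hgS a ha) (hgR a ha)
    refine Finset.mem_filter.2 ⟨hgS a ha, fun h0 => ha'.2 ?_⟩
    rwa [h0, add_zero] at this
  refine Finset.sum_involution g ?_ ?_ hmem ?_
  · exact fun a ha => hcancel a (Finset.mem_filter.1 ha).1 _ (hgS a ha) (hgR a ha)
  · exact fun a ha _ he => hirr a (by simpa [he] using hgR a ha)
  · exact fun a ha => huniq (g a ha) (hgS a ha) _ (hgS _ (hmem a ha)) _ (Finset.mem_filter.1 ha).1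
      (hgR _ (hmem a ha)) (hsymm _ _ (hgR a ha))

/-! ### Normal components and cancellation across faces. -/

section Mesh

variable {d : ℕ} {Ω : Set (EuclideanSpace ℝ (Fin d))}
  {𝒯 : Finset (Finset (EuclideanSpace ℝ (Fin d)))}
  {T T' : Finset (EuclideanSpace ℝ (Fin d))} {p p' q x : EuclideanSpace ℝ (Fin d)}

namespace IsConformingMesh

/-- The gradient of a barycentric coordinate. -/
noncomputable def coordGradient (h : IsConformingMesh Ω 𝒯) (hT : T ∈ 𝒯) (hp : p ∈ T) :
    EuclideanSpace ℝ (Fin d) :=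
  (InnerProductSpace.toDual ℝ _).symm (LinearMap.toContinuousLinearMap (h.coord hT hp).linear)

lemma inner_coordGradient (h : IsConformingMesh Ω 𝒯) (hT : T ∈ 𝒯) (hp : p ∈ T)
    (u : EuclideanSpace ℝ (Fin d)) :
    inner ℝ (h.coordGradient hT hp) u = (h.coord hT hp).linear u := by
  rw [coordGradient, InnerProductSpace.toDual_symm_apply, LinearMap.coe_toContinuousLinearMap']

lemma coord_linear_sub (h : IsConformingMesh Ω 𝒯) (hT : T ∈ 𝒯) (hp : p ∈ T)
    (x y : EuclideanSpace ℝ (Fin d)) :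
    (h.coord hT hp).linear (x - y) = h.coord hT hp x - h.coord hT hp y :=
  (h.coord hT hp).linearMap_vsub x y

variable [DecidableEq (EuclideanSpace ℝ (Fin d))]

lemma isSubsimplex_erase (h : IsConformingMesh Ω 𝒯) (hT : T ∈ 𝒯) (hd : 1 ≤ d) (hp : p ∈ T) :
    IsSubsimplex (d - 1) (T.erase p) T :=
  ⟨Finset.erase_subset _ _, by rw [Finset.card_erase_of_mem hp, h.card_eq T hT]; omega⟩

lemma coordGradient_ne_zero (h : IsConformingMesh Ω 𝒯) (hT : T ∈ 𝒯) (hd : 1 ≤ d) (hp : p ∈ T) :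
    h.coordGradient hT hp ≠ 0 := by
  intro h0
  obtain ⟨q, hq⟩ : (T.erase p).Nonempty := by
    rw [← Finset.card_pos, (h.isSubsimplex_erase hT hd hp).2]; omega
  have hq := Finset.mem_erase.1 hq
  have h1 := h.inner_coordGradient hT hp (p - q)
  rw [h0, inner_zero_left, h.coord_linear_sub, h.coord_self, h.coord_of_ne hT hp hq.2 hq.1] at h1
  norm_num at h1

lemma isUnitNormal_coordGradient (h : IsConformingMesh Ω 𝒯) (hT : T ∈ 𝒯) (hd : 1 ≤ d)
    (hp : p ∈ T) : IsUnitNormal (T.erase p)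
      (‖h.coordGradient hT hp‖⁻¹ • h.coordGradient hT hp) := by
  refine ⟨norm_smul_inv_norm (h.coordGradient_ne_zero hT hd hp), fun q hq r hr => ?_⟩
  have hq := Finset.mem_erase.1 hq
  have hr := Finset.mem_erase.1 hr
  rw [inner_smul_left, h.inner_coordGradient, h.coord_linear_sub,
    h.coord_of_ne hT hp hq.2 hq.1, h.coord_of_ne hT hp hr.2 hr.1]
  simp

/-- The flux coefficients of a field with continuous normal component match across a face. -/
lemma coeff_eq_of_normal_jump (h : IsConformingMesh Ω 𝒯) (hT : T ∈ 𝒯) (hd : 1 ≤ d)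
    (hp : p ∈ T) (hp' : p' ∈ T') (hF : T.erase p = T'.erase p')
    {a a' : EuclideanSpace ℝ (Fin d)} {β β' : ℝ} {c : T → ℝ} {c' : T' → ℝ}
    (hc : ∀ x, ∑ q, c q • (x - (q : EuclideanSpace ℝ (Fin d))) = a + β • x) (hc' : ∀ x, ∑ q, c' q • (x - (q : EuclideanSpace ℝ (Fin d))) = a' + β' • x)
    (hn : ∀ n, IsUnitNormal (T.erase p) n → ∀ x ∈ simplexHull (T.erase p),
      inner ℝ (a + β • x) n - inner ℝ (a' + β' • x) n = 0) :
    c ⟨p, hp⟩ = h.coord hT hp p' * c' ⟨p', hp'⟩ := by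
  obtain ⟨x, hxF, hx0, -⟩ := h.exists_forall_coord_pos hT hd hp
  have h1 := hn _ (h.isUnitNormal_coordGradient hT hd hp) x hxF
  rw [inner_smul_right, inner_smul_right, ← mul_sub] at h1
  have h2 := (mul_eq_zero.1 h1).resolve_left
    (inv_ne_zero (norm_ne_zero_iff.2 (h.coordGradient_ne_zero hT hd hp)))
  rw [real_inner_comm, h.inner_coordGradient, real_inner_comm, h.inner_coordGradient, ← hc,
    ← hc', map_sum, map_sum] at h2
  simp only [map_smul, h.coord_linear_sub, hx0, zero_sub, smul_eq_mul] at h2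
  -- At `x` the coordinate of `p` is zero, so the term of a vertex `q` is its coefficient times
  -- minus the coordinate at `q`. This coordinate vanishes on the face, leaving only `p` in `T` and
  -- only `p'` in `T'`.
  rw [Finset.sum_eq_single (⟨p, hp⟩ : T), Finset.sum_eq_single (⟨p', hp'⟩ : T')] at h2
  · simp only [h.coord_self] at h2
    linarith
  · rintro ⟨q, hq⟩ - hne
    have hqp : q ≠ p' := fun e => hne (Subtype.ext e)
    have := Finset.mem_erase.1 (hF ▸ Finset.mem_erase.2 ⟨hqp, hq⟩ : q ∈ T.erase p)
    simp [h.coord_of_ne hT hp this.2 this.1]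
  · simp
  · rintro ⟨q, hq⟩ - hne
    simp [h.coord_of_ne hT hp hq fun e => hne (Subtype.ext e)]
  · simp

/-- Elementwise divergence theorem for a Raviart--Thomas field and an elementwise `C¹` function
whose jumps carry no flux. -/
theorem sum_setIntegral_eq_zero (h : IsConformingMesh Ω 𝒯) (hΩ : IsOpen Ω) (hd : 1 ≤ d)
    {a : Finset (EuclideanSpace ℝ (Fin d)) → EuclideanSpace ℝ (Fin d)}
    {β : Finset (EuclideanSpace ℝ (Fin d)) → ℝ}
    (hn : ∀ F T₁ T₂, IsInteriorFace Ω 𝒯 F T₁ T₂ → ∀ n, IsUnitNormal F n → ∀ x ∈ simplexHull F,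
      inner ℝ (a T₁ + β T₁ • x) n - inner ℝ (a T₂ + β T₂ • x) n = 0)
    {g : Finset (EuclideanSpace ℝ (Fin d)) → EuclideanSpace ℝ (Fin d) → ℝ}
    (hg : ∀ T ∈ 𝒯, ContDiff ℝ 1 (g T))
    (hint : ∀ T₁ T₂, ∀ p ∈ T₁, IsInteriorFace Ω 𝒯 (T₁.erase p) T₁ T₂ →
      coneFlux volume (simplexHull T₁) p (fun x => g T₁ x - g T₂ x) = 0)
    (hbd : ∀ T, ∀ p ∈ T, IsBoundaryFace Ω 𝒯 (T.erase p) T →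
      coneFlux volume (simplexHull T) p (g T) = 0) :
    ∑ T ∈ 𝒯, ∫ x in simplexHull T,
      (fderiv ℝ (g T) x (a T + β T • x) + d * β T * g T x) = 0 := by
  have hex : ∀ T : Finset (EuclideanSpace ℝ (Fin d)), ∃ c : T → ℝ, T ∈ 𝒯 →
      ∑ q, c q = β T ∧ ∀ x, ∑ q, c q • (x - (q : EuclideanSpace ℝ (Fin d))) = a T + β T • x := by
    intro T
    by_cases hT : T ∈ 𝒯
    · obtain ⟨c, hc⟩ := (h.basis hT).exists_affineField_eq (a T) (β T)
      exact ⟨c, fun _ => hc⟩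
    · exact ⟨0, fun hT' => absurd hT' hT⟩
  choose c hc using hex
  have h1 : ∀ T ∈ 𝒯, ∫ x in simplexHull T,
      (fderiv ℝ (g T) x (a T + β T • x) + d * β T * g T x) =
      ∑ q : T, c T q * coneFlux volume (simplexHull T) q (g T) := by
    intro T hT
    have := integral_affineField_eq_sum_coneFlux volume (h.basis hT)
      (isCompact_simplexHull (T := T)) (hg T hT) (c T)
    refine Eq.trans ?_ this
    congr 1
    ext x
    rw [← (hc T hT).2, ← (hc T hT).1]
    simp
  rw [Finset.sum_congr rfl h1, Finset.sum_sigma']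
  -- A pair (element, vertex) stands for the opposite face seen from that element. Partners are the
  -- two sides of a face not contained in the boundary.
  refine Finset.sum_eq_zero_of_pairing _ _ (fun i j => i.1 ≠ j.1 ∧ i.1.erase i.2 = j.1.erase j.2 ∧
    ¬ simplexHull (i.1.erase i.2) ⊆ frontier Ω) ?_ ?_ ?_ ?_ ?_
  · rintro i j ⟨h1, h2, h3⟩
    exact ⟨h1.symm, h2.symm, h2 ▸ h3⟩
  · exact fun i hi => hi.1 rfl
  · rintro ⟨T, p, hp⟩ hi hne
    have hT := (Finset.mem_sigma.1 hi).1
    have hF : ¬ simplexHull (T.erase p) ⊆ frontier Ω := fun hF => hne <| by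
      show c T ⟨p, hp⟩ * coneFlux volume (simplexHull T) p (g T) = 0
      rw [hbd T p hp ⟨hT, h.isSubsimplex_erase hT hd hp, hF⟩, mul_zero]
    obtain ⟨T', hT', hTT, hsub⟩ := h.exists_neighbor hT hΩ hd hp hF
    -- The neighbour has exactly one vertex outside the face, and this vertex is the partner.
    have hcard : (T' \ T.erase p).card = 1 := by
      rw [Finset.card_sdiff_of_subset hsub, (h.isSubsimplex_erase hT hd hp).2, h.card_eq T' hT']
      omega
    obtain ⟨p', hp'⟩ := Finset.card_eq_one.1 hcard
    have hp'T : p' ∈ T' := (Finset.mem_sdiff.1 (hp' ▸ Finset.mem_singleton_self p')).1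
    refine ⟨⟨T', p', hp'T⟩, by simp [hT'], hTT.symm, ?_, hF⟩
    show T.erase p = T'.erase p'
    rw [← Finset.sdiff_singleton_eq_erase p' T', ← hp', Finset.sdiff_sdiff_eq_self hsub]
  · rintro ⟨T, p, hp⟩ hi ⟨T', p', hp'⟩ hj ⟨T'', p'', hp''⟩ hk ⟨h1, h2, h3⟩ ⟨h1', h2', h3'⟩
    simp only at h1 h2 h1' h2'
    have hT := (Finset.mem_sigma.1 hi).1
    have hT' := (Finset.mem_sigma.1 hj).1
    have hT'' := (Finset.mem_sigma.1 hk).1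
    obtain rfl := h.eq_of_erase_eq hT hT' hd hT'' hp hp' hp'' h1 h1' h2 h2'
    have : p' = p'' := by
      by_contra hne
      have := h2.symm.trans h2' ▸ Finset.mem_erase.2 ⟨Ne.symm hne, hp''⟩
      exact (Finset.mem_erase.1 this).1 rfl
    subst this
    rfl
  · rintro ⟨T, p, hp⟩ hi ⟨T', p', hp'⟩ hj ⟨h1, h2, h3⟩
    simp only at h1 h2 h3 ⊢
    have hT := (Finset.mem_sigma.1 hi).1
    have hT' := (Finset.mem_sigma.1 hj).1
    have hface : IsInteriorFace Ω 𝒯 (T.erase p) T T' :=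
      ⟨hT, hT', h1, h.isSubsimplex_erase hT hd hp, h2 ▸ h.isSubsimplex_erase hT' hd hp', h3⟩
    have e1 := h.coeff_eq_of_normal_jump hT hd hp hp' h2 (hc T hT).2 (hc T' hT').2
      (hn _ T T' hface)
    have e2 := h.coneFlux_neighbor hT hT' hd h1 hp hp' h2 (hg T' hT')
    have e3 := hint T T' p hp hface
    rw [coneFlux_sub volume isCompact_simplexHull p (hg T hT) (hg T' hT'), sub_eq_zero] at e3
    -- The factor `h.coord hT hp p'` enters once through the coefficients and once, with a minus
    -- sign, through the fluxes.
    rw [e1, e2, e3]; ring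

end IsConformingMesh

end Mesh

/-! ### Pairings of square integrable functions. -/

section SquareIntegrable

variable {α F : Type*} [MeasurableSpace α] {μ : Measure α} [NormedAddCommGroup F]
  [InnerProductSpace ℝ F]

lemma MeasureTheory.MemLp.integrable_inner_two {u w : α → F} (hu : MemLp u 2 μ) (hw : MemLp w 2 μ) :
    Integrable (fun x => inner ℝ (u x) (w x)) μ := by
  rw [← memLp_one_iff_integrable]
  refine MemLp.of_bilin (fun a b => inner ℝ a b) 1 hu hw (hu.1.inner hw.1)
    (ae_of_all _ fun x => ?_)
  rw [one_mul]
  exact nnnorm_inner_le_nnnorm _ _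

lemma MeasureTheory.MemLp.integrable_mul_two {u w : α → ℝ} (hu : MemLp u 2 μ) (hw : MemLp w 2 μ) :
    Integrable (fun x => u x * w x) μ := hu.integrable_mul hw

/-- By Cauchy-Schwarz, convergence in `L²` gives convergence in `L¹` of the products. -/
lemma tendsto_integral_inner_of_tendsto_eLpNorm {u w : α → F} {f : ℕ → α → F} (hu : MemLp u 2 μ)
    (hw : MemLp w 2 μ) (hf : ∀ k, MemLp (f k) 2 μ)
    (hlim : Tendsto (fun k => eLpNorm (fun x => f k x - w x) 2 μ) atTop (𝓝 0)) :
    Tendsto (fun k => ∫ x, inner ℝ (u x) (f k x) ∂μ) atTop (𝓝 (∫ x, inner ℝ (u x) (w x) ∂μ)) := by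
  refine tendsto_integral_of_L1' _ (hu.integrable_inner_two hw).1
    (Eventually.of_forall fun k => hu.integrable_inner_two (hf k)) ?_
  have hb : Tendsto (fun k => eLpNorm u 2 μ * eLpNorm (fun x => f k x - w x) 2 μ) atTop (𝓝 0) := by
    have := ENNReal.Tendsto.const_mul (a := eLpNorm u 2 μ) hlim (Or.inr hu.2.ne)
    rwa [mul_zero] at this
  refine tendsto_of_tendsto_of_tendsto_of_le_of_le tendsto_const_nhds hb (fun _ => zero_le)
    fun k => ?_
  have := eLpNorm_le_eLpNorm_mul_eLpNorm_of_nnnorm (p := 2) (q := 2) (r := 1) hu.1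
    ((hf k).1.sub hw.1) (fun a b => inner ℝ a b) 1 (ae_of_all _ fun x => by
      rw [one_mul]; exact nnnorm_inner_le_nnnorm (𝕜 := ℝ) _ _)
  rw [ENNReal.coe_one, one_mul] at this
  refine le_trans (le_of_eq ?_) this
  congr 1
  ext x
  simp [inner_sub_right]

end SquareIntegrable

/-! ### Weak gradients and divergences: classical case, uniqueness, limits. -/

section WeakDerivative

variable {d : ℕ} {U : Set (EuclideanSpace ℝ (Fin d))}

lemma EuclideanSpace.gradient_apply {η : EuclideanSpace ℝ (Fin d) → ℝ}
    (x : EuclideanSpace ℝ (Fin d)) (hη : DifferentiableAt ℝ η x) (i : Fin d) :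
    gradient η x i = fderiv ℝ η x (EuclideanSpace.single i 1) := by
  have := hη.hasGradientAt.fderiv_apply (y := EuclideanSpace.single i (1 : ℝ))
  rw [this, EuclideanSpace.inner_single_right]
  simp

lemma IsTestFunction.setIntegral_eq {η : EuclideanSpace ℝ (Fin d) → ℝ} (hη : IsTestFunction U η)
    {f : EuclideanSpace ℝ (Fin d) → ℝ} (hf : ∀ x, x ∉ tsupport η → f x = 0) :
    ∫ x in U, f x = ∫ x, f x :=
  setIntegral_eq_integral_of_forall_compl_eq_zero fun x hx => hf x fun h => hx (hη.2.2 h)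

lemma IsTestFunction.differentiable {η : EuclideanSpace ℝ (Fin d) → ℝ} (hη : IsTestFunction U η) :
    Differentiable ℝ η := hη.1.differentiable (by simp)

lemma IsTestFunction.gradient_eq_zero {η : EuclideanSpace ℝ (Fin d) → ℝ}
    {x : EuclideanSpace ℝ (Fin d)} (hx : x ∉ tsupport η) : gradient η x = 0 := by
  have : fderiv ℝ η x = 0 := by
    by_contra hne
    exact hx (support_fderiv_subset ℝ hne)
  simp [gradient, this]

lemma ContDiff.continuous_gradient {f : EuclideanSpace ℝ (Fin d) → ℝ} (hf : ContDiff ℝ 1 f) :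
    Continuous (gradient f) :=
  (LinearIsometryEquiv.continuous _).comp (hf.continuous_fderiv one_ne_zero)

lemma IsTestFunction.continuous_gradient {η : EuclideanSpace ℝ (Fin d) → ℝ}
    (hη : IsTestFunction U η) : Continuous (gradient η) :=
  (hη.1.of_le (by simp)).continuous_gradient

lemma IsTestFunction.setIntegral_mul_gradient {η : EuclideanSpace ℝ (Fin d) → ℝ}
    (hη : IsTestFunction U η) {f : EuclideanSpace ℝ (Fin d) → ℝ} (hf : ContDiff ℝ 1 f) (i : Fin d) :
    ∫ x in U, f x * gradient η x i = - ∫ x in U, gradient f x i * η x := by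
  have hη0 : ∀ x, x ∉ tsupport η → η x = 0 := fun x hx => image_eq_zero_of_notMem_tsupport hx
  have hηc : Continuous η := hη.1.continuous
  have hfd := hf.differentiable one_ne_zero
  rw [hη.setIntegral_eq fun x hx => by simp [IsTestFunction.gradient_eq_zero hx],
    hη.setIntegral_eq fun x hx => by rw [hη0 x hx, mul_zero]]
  simp_rw [EuclideanSpace.gradient_apply _ (hη.differentiable _),
    EuclideanSpace.gradient_apply _ (hfd _)]
  have hfc := (hf.continuous_fderiv one_ne_zero).clm_apply
    (continuous_const (y := EuclideanSpace.single i (1 : ℝ)))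
  have hgc := (hη.1.continuous_fderiv (by simp)).clm_apply
    (continuous_const (y := EuclideanSpace.single i (1 : ℝ)))
  have hgs : HasCompactSupport fun x => fderiv ℝ η x (EuclideanSpace.single i (1 : ℝ)) :=
    (hη.2.1.fderiv (𝕜 := ℝ)).comp_left (g := fun L : EuclideanSpace ℝ (Fin d) →L[ℝ] ℝ => L (EuclideanSpace.single i (1 : ℝ)))
      (by simp)
  refine integral_mul_fderiv_eq_neg_fderiv_mul_of_integrable ?_ ?_ ?_ (fun x _ => hfd x)
    (fun x _ => hη.differentiable x)
  · exact (hfc.mul hηc).integrable_of_hasCompactSupport hη.2.1.mul_left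
  · exact (hf.continuous.mul hgc).integrable_of_hasCompactSupport hgs.mul_left
  · exact (hf.continuous.mul hηc).integrable_of_hasCompactSupport hη.2.1.mul_left

lemma Continuous.memLp_restrict_of_isBounded {F : Type*} [NormedAddCommGroup F]
    [SecondCountableTopology F] {f : EuclideanSpace ℝ (Fin d) → F}
    (hf : Continuous f) (hU : Bornology.IsBounded U) (p : ENNReal) :
    MemLp f p (volume.restrict U) := by
  have hK : IsCompact (closure U) := hU.isCompact_closure
  have : Fact (volume (closure U) < ⊤) := ⟨hK.measure_lt_top⟩
  obtain ⟨C, hC⟩ := hK.exists_bound_of_continuousOn hf.continuousOn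
  exact MemLp.mono_measure (Measure.restrict_mono subset_closure le_rfl)
    (MemLp.of_bound hf.aestronglyMeasurable C
    ((ae_restrict_iff' hK.measurableSet).2 (ae_of_all _ hC)))

lemma ContDiff.hasWeakGradient {f : EuclideanSpace ℝ (Fin d) → ℝ} (hf : ContDiff ℝ 1 f)
    (hU : Bornology.IsBounded U) : HasWeakGradient U f (gradient f) where
  memLp := hf.continuous.memLp_restrict_of_isBounded hU 2
  memLp_gradient := hf.continuous_gradient.memLp_restrict_of_isBounded hU 2
  integral_eq _ hη i := hη.setIntegral_mul_gradient hf i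

lemma HasWeakGradient.congr {f f' : EuclideanSpace ℝ (Fin d) → ℝ}
    {G G' : EuclideanSpace ℝ (Fin d) → EuclideanSpace ℝ (Fin d)} (h : HasWeakGradient U f G)
    (hf : f =ᵐ[volume.restrict U] f') (hG : G =ᵐ[volume.restrict U] G') :
    HasWeakGradient U f' G' where
  memLp := (memLp_congr_ae hf).1 h.memLp
  memLp_gradient := (memLp_congr_ae hG).1 h.memLp_gradient
  integral_eq η hη i := by
    have h1 : ∫ x in U, f' x * gradient η x i = ∫ x in U, f x * gradient η x i :=
      integral_congr_ae (hf.mono fun x hx => by simp only [hx])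
    have h2 : ∫ x in U, G' x i * η x = ∫ x in U, G x i * η x :=
      integral_congr_ae (hG.mono fun x hx => by simp only [hx])
    rw [h1, h2, h.integral_eq η hη i]

lemma HasWeakDivergence.congr {f f' : EuclideanSpace ℝ (Fin d) → EuclideanSpace ℝ (Fin d)}
    {D : EuclideanSpace ℝ (Fin d) → ℝ} (h : HasWeakDivergence U f D)
    (hf : f =ᵐ[volume.restrict U] f') {D' : EuclideanSpace ℝ (Fin d) → ℝ}
    (hD : D =ᵐ[volume.restrict U] D') : HasWeakDivergence U f' D' where
  memLp := (memLp_congr_ae hf).1 h.memLp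
  memLp_divergence := (memLp_congr_ae hD).1 h.memLp_divergence
  integral_eq η hη := by
    have h1 : ∫ x in U, inner ℝ (f' x) (gradient η x) = ∫ x in U, inner ℝ (f x) (gradient η x) :=
      integral_congr_ae (hf.mono fun x hx => by simp only [hx])
    have h2 : ∫ x in U, D' x * η x = ∫ x in U, D x * η x :=
      integral_congr_ae (hD.mono fun x hx => by simp only [hx])
    rw [h1, h2, h.integral_eq η hη]

/-- The fundamental lemma of the calculus of variations; boundedness of `U` puts `L²` functions in
`L¹`. -/
lemma ae_eq_of_forall_integral_mul_testFunction_eq (hU : IsOpen U)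
    (hUb : Bornology.IsBounded U) {f g : EuclideanSpace ℝ (Fin d) → ℝ}
    (hf : MemLp f 2 (volume.restrict U)) (hg : MemLp g 2 (volume.restrict U))
    (h : ∀ η, IsTestFunction U η → ∫ x in U, f x * η x = ∫ x in U, g x * η x) :
    f =ᵐ[volume.restrict U] g := by
  have : Fact (volume U < ⊤) := ⟨hUb.measure_lt_top⟩
  have hfi : IntegrableOn f U := hf.integrable (by norm_num)
  have hgi : IntegrableOn g U := hg.integrable (by norm_num)
  have key := hU.ae_eq_zero_of_integral_contDiff_smul_eq_zero (μ := volume) (f := fun x => f x - g x)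
    ((hfi.sub hgi).locallyIntegrableOn) fun η h1 h2 h3 => by
      have hη : IsTestFunction U η := ⟨h1, h2, h3⟩
      have hη2 : MemLp η 2 (volume.restrict U) :=
        h1.continuous.memLp_restrict_of_isBounded hUb 2
      rw [← hη.setIntegral_eq fun x hx => by
        rw [image_eq_zero_of_notMem_tsupport hx, zero_smul]]
      simp_rw [smul_eq_mul, mul_sub, mul_comm (η _)]
      rw [integral_sub (hf.integrable_mul_two hη2) (hg.integrable_mul_two hη2), h η hη, sub_self]
  rw [EventuallyEq, ae_restrict_iff' hU.measurableSet]
  filter_upwards [key] with x hx hxU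
  exact sub_eq_zero.1 (hx hxU)

/-- Uniqueness allows an arbitrary broken gradient to be replaced by the explicit one. -/
lemma HasWeakGradient.unique (hU : IsOpen U) (hUb : Bornology.IsBounded U)
    {f : EuclideanSpace ℝ (Fin d) → ℝ}
    {G G' : EuclideanSpace ℝ (Fin d) → EuclideanSpace ℝ (Fin d)} (h : HasWeakGradient U f G)
    (h' : HasWeakGradient U f G') : G =ᵐ[volume.restrict U] G' := by
  have key : ∀ i, ∀ᵐ x ∂(volume.restrict U), G x i = G' x i := fun i =>
    ae_eq_of_forall_integral_mul_testFunction_eq hU hUb (h.memLp_gradient.eval_piLp i)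
      (h'.memLp_gradient.eval_piLp i) fun η hη => by
        rw [← neg_inj, ← h.integral_eq η hη i, h'.integral_eq η hη i]
  filter_upwards [ae_all_iff.2 key] with x hx
  ext i
  exact hx i

lemma HasWeakDivergence.unique (hU : IsOpen U) (hUb : Bornology.IsBounded U)
    {v : EuclideanSpace ℝ (Fin d) → EuclideanSpace ℝ (Fin d)}
    {D D' : EuclideanSpace ℝ (Fin d) → ℝ} (h : HasWeakDivergence U v D)
    (h' : HasWeakDivergence U v D') : D =ᵐ[volume.restrict U] D' :=
  ae_eq_of_forall_integral_mul_testFunction_eq hU hUb h.memLp_divergence h'.memLp_divergence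
    fun η hη => by rw [← neg_inj, ← h.integral_eq η hη, h'.integral_eq η hη]

lemma hasWeakDivergence_affine (hUb : Bornology.IsBounded U) (a : EuclideanSpace ℝ (Fin d))
    (β : ℝ) : HasWeakDivergence U (fun x => a + β • x) (fun _ => d * β) where
  memLp := Continuous.memLp_restrict_of_isBounded (by fun_prop) hUb 2
  memLp_divergence := Continuous.memLp_restrict_of_isBounded (by fun_prop) hUb 2
  integral_eq η hη := by
    have hf : ∀ i : Fin d, ContDiff ℝ 1 fun x : EuclideanSpace ℝ (Fin d) => a i + β * x i :=
      fun i => by fun_prop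
    have hgrad : ∀ i x, gradient (fun x : EuclideanSpace ℝ (Fin d) => a i + β * x i) x i = β := by
      intro i x
      rw [EuclideanSpace.gradient_apply _ ((hf i).differentiable one_ne_zero x)]
      have : HasFDerivAt (fun x : EuclideanSpace ℝ (Fin d) => a i + β * x i)
          (β • (EuclideanSpace.proj i : EuclideanSpace ℝ (Fin d) →L[ℝ] ℝ)) x :=
        (((EuclideanSpace.proj i : EuclideanSpace ℝ (Fin d) →L[ℝ] ℝ).hasFDerivAt).const_mul
          β).const_add (a i)
      rw [this.fderiv]; simp
    have h1 : ∀ i, ∫ x in U, (a i + β * x i) * gradient η x i = - ∫ x in U, β * η x := fun i => by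
      rw [hη.setIntegral_mul_gradient (hf i) i]; simp_rw [hgrad]
    have h2 : ∀ x, inner ℝ (a + β • x) (gradient η x) =
        ∑ i, (a i + β * x i) * gradient η x i := fun x => by
      rw [PiLp.inner_apply]
      exact Finset.sum_congr rfl fun i _ => by simp [mul_comm]
    simp_rw [h2]
    rw [integral_finsetSum _ fun i _ => ?_, Finset.sum_congr rfl fun i _ => h1 i]
    · simp only [Finset.sum_const, Finset.card_univ, Fintype.card_fin, nsmul_eq_mul,
        integral_const_mul]
      ring
    · refine (MemLp.integrable_mul (p := 2) (q := 2) ?_ ?_)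
      · exact (hf i).continuous.memLp_restrict_of_isBounded hUb 2
      · exact (hη.continuous_gradient.memLp_restrict_of_isBounded hUb 2).eval_piLp i

lemma HasWeakGradient.add (hUb : Bornology.IsBounded U) {f f' : EuclideanSpace ℝ (Fin d) → ℝ}
    {G G' : EuclideanSpace ℝ (Fin d) → EuclideanSpace ℝ (Fin d)} (h : HasWeakGradient U f G)
    (h' : HasWeakGradient U f' G') :
    HasWeakGradient U (fun x => f x + f' x) (fun x => G x + G' x) where
  memLp := h.memLp.add h'.memLp
  memLp_gradient := h.memLp_gradient.add h'.memLp_gradient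
  integral_eq η hη i := by
    have hη2 : MemLp η 2 (volume.restrict U) :=
      hη.1.continuous.memLp_restrict_of_isBounded hUb 2
    have hg2 : MemLp (fun x => gradient η x i) 2 (volume.restrict U) :=
      (hη.continuous_gradient.memLp_restrict_of_isBounded hUb 2).eval_piLp i
    simp_rw [PiLp.add_apply, add_mul]
    rw [integral_add (h.memLp.integrable_mul_two hg2) (h'.memLp.integrable_mul_two hg2),
      integral_add ((h.memLp_gradient.eval_piLp i).integrable_mul_two hη2)
        ((h'.memLp_gradient.eval_piLp i).integrable_mul_two hη2), h.integral_eq η hη i,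
      h'.integral_eq η hη i]
    ring

/-- A limit in `H¹` of test functions on a larger set has a weak gradient. -/
lemma HasWeakGradient.of_tendsto (hUb : Bornology.IsBounded U) {Ω : Set (EuclideanSpace ℝ (Fin d))}
    {f : EuclideanSpace ℝ (Fin d) → ℝ}
    {G : EuclideanSpace ℝ (Fin d) → EuclideanSpace ℝ (Fin d)} (hf : MemLp f 2 (volume.restrict U))
    (hG : MemLp G 2 (volume.restrict U)) {ζ : ℕ → EuclideanSpace ℝ (Fin d) → ℝ}
    (hζ : ∀ k, IsTestFunction Ω (ζ k))
    (hlim : Tendsto (fun k => eLpNorm (fun x => ζ k x - f x) 2 (volume.restrict U)) atTop (𝓝 0))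
    (hlimG : Tendsto (fun k => eLpNorm (fun x => gradient (ζ k) x - G x) 2 (volume.restrict U))
      atTop (𝓝 0)) : HasWeakGradient U f G where
  memLp := hf
  memLp_gradient := hG
  integral_eq η hη i := by
    have hη2 : MemLp η 2 (volume.restrict U) :=
      hη.1.continuous.memLp_restrict_of_isBounded hUb 2
    have hg2 : MemLp (fun x => gradient η x i) 2 (volume.restrict U) :=
      (hη.continuous_gradient.memLp_restrict_of_isBounded hUb 2).eval_piLp i
    have hlimi : Tendsto (fun k => eLpNorm (fun x => gradient (ζ k) x i - G x i) 2
        (volume.restrict U)) atTop (𝓝 0) :=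
      tendsto_of_tendsto_of_tendsto_of_le_of_le tendsto_const_nhds hlimG (fun _ => zero_le)
        fun k => eLpNorm_mono fun x => PiLp.norm_apply_le (gradient (ζ k) x - G x) i
    have h1 := tendsto_integral_inner_of_tendsto_eLpNorm hg2 hf
      (fun k => (hζ k).1.continuous.memLp_restrict_of_isBounded hUb 2) hlim
    have h2 := tendsto_integral_inner_of_tendsto_eLpNorm hη2 (hG.eval_piLp i)
      (fun k => ((hζ k).continuous_gradient.memLp_restrict_of_isBounded hUb 2).eval_piLp i) hlimi
    refine tendsto_nhds_unique h1 (h2.neg.congr fun k => ?_)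
    exact (hη.setIntegral_mul_gradient ((hζ k).1.of_le (by simp)) i).symm

end WeakDerivative

/-! ### Polynomials of low degree. -/

section Polynomial

namespace MvPolynomial

variable {σ : Type*}

/-- The index of `M` is a degree bound, not the exact degree, so that sums stay at the same index
and only multiplication by a variable raises it. -/
lemma induction_on_totalDegree_le {R : Type*} [CommSemiring R]
    {M : ℕ → MvPolynomial σ R → Prop} (hC : ∀ n c, M n (C c))
    (hadd : ∀ n p q, M n p → M n q → M n (p + q)) (hX : ∀ n p i, M n p → M (n + 1) (p * X i))
    {n : ℕ} {p : MvPolynomial σ R} (hp : p.totalDegree ≤ n) : M n p := by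
  classical
  have hmon : ∀ n (s : σ →₀ ℕ) (c : R), s.degree ≤ n → M n (monomial s c) := by
    intro n
    induction n with
    | zero =>
      intro s c hs
      have : s = 0 := (Finsupp.degree_eq_zero_iff s).1 (Nat.le_zero.1 hs)
      subst this
      exact hC 0 c
    | succ n ih =>
      intro s c hs
      by_cases h0 : s = 0
      · subst h0; exact hC _ c
      obtain ⟨i, hi⟩ := Finsupp.ne_iff.1 h0
      have hle : Finsupp.single i 1 ≤ s := Finsupp.single_le_iff.2 (Nat.one_le_iff_ne_zero.2 hi)
      have hs' : s - Finsupp.single i 1 + Finsupp.single i 1 = s := tsub_add_cancel_of_le hle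
      have hdeg : (s - Finsupp.single i 1).degree + 1 = s.degree := by
        conv_rhs => rw [← hs']
        rw [map_add, Finsupp.degree_single]
      have := hX n _ i (ih (s - Finsupp.single i 1) c (by omega))
      rwa [X, monomial_mul, mul_one, hs'] at this
  have hsum : ∀ S : Finset (σ →₀ ℕ), (∀ s ∈ S, s.degree ≤ n) →
      M n (∑ s ∈ S, monomial s (coeff s p)) := by
    intro S
    induction S using Finset.induction_on with
    | empty => intro _; simpa using hC n 0
    | insert s S hs ih =>
      intro h
      rw [Finset.sum_insert hs]
      exact hadd n _ _ (hmon n s _ (h s (Finset.mem_insert_self _ _)))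
        (ih fun t ht => h t (Finset.mem_insert_of_mem ht))
  rw [p.as_sum]
  exact hsum _ fun s hs => (le_totalDegree hs).trans hp

lemma totalDegree_pderiv_le {R : Type*} [CommSemiring R] (i : σ) (p : MvPolynomial σ R) :
    (pderiv i p).totalDegree ≤ p.totalDegree - 1 := by
  classical
  conv_lhs => rw [p.as_sum, map_sum]
  refine totalDegree_finsetSum_le fun s hs => ?_
  rw [pderiv_monomial]
  by_cases hi : s i = 0
  · simp [hi]
  have hle : Finsupp.single i 1 ≤ s := Finsupp.single_le_iff.2 (Nat.one_le_iff_ne_zero.2 hi)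
  have hs' : s - Finsupp.single i 1 + Finsupp.single i 1 = s := tsub_add_cancel_of_le hle
  have hdeg : (s - Finsupp.single i 1).degree + 1 = s.degree := by
    conv_rhs => rw [← hs']
    rw [map_add, Finsupp.degree_single]
  have h1 : (s - Finsupp.single i 1).degree ≤ p.totalDegree - 1 := by
    have : s.degree ≤ p.totalDegree := le_totalDegree hs
    omega
  exact (totalDegree_monomial_le _ _).trans h1

end MvPolynomial

variable {d : ℕ}

lemma MvPolynomial.hasFDerivAt_eval (p : MvPolynomial (Fin d) ℝ) (x : EuclideanSpace ℝ (Fin d)) :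
    HasFDerivAt (fun x : EuclideanSpace ℝ (Fin d) => MvPolynomial.eval (fun i => x i) p)
      (∑ i, MvPolynomial.eval (fun j => x j) (MvPolynomial.pderiv i p) •
        (EuclideanSpace.proj i : EuclideanSpace ℝ (Fin d) →L[ℝ] ℝ)) x := by
  induction p using MvPolynomial.induction_on with
  | C c => simpa using hasFDerivAt_const c x
  | add p q hp hq =>
    simp only [map_add, add_smul, Finset.sum_add_distrib]
    exact hp.add hq
  | mul_X p j hp =>
    have hX : HasFDerivAt (fun x : EuclideanSpace ℝ (Fin d) => x j)
        (EuclideanSpace.proj j : EuclideanSpace ℝ (Fin d) →L[ℝ] ℝ) x :=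
      (EuclideanSpace.proj j : EuclideanSpace ℝ (Fin d) →L[ℝ] ℝ).hasFDerivAt
    have := hp.mul hX
    simp only [map_mul, MvPolynomial.eval_X]
    refine this.congr_fderiv ?_
    ext u
    simp [MvPolynomial.pderiv_X, Pi.single_apply, add_mul,
      Finset.sum_add_distrib, Finset.mul_sum]
    simp only [apply_ite (MvPolynomial.eval (x : Fin d → ℝ)), map_zero, ite_mul, zero_mul,
      Finset.sum_ite_eq, Finset.mem_univ, if_true]
    congr 1
    exact Finset.sum_congr rfl fun i _ => by ring

lemma MvPolynomial.contDiff_eval (p : MvPolynomial (Fin d) ℝ) :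
    ContDiff ℝ 1 (fun x : EuclideanSpace ℝ (Fin d) => MvPolynomial.eval (fun i => x i) p) := by
  induction p using MvPolynomial.induction_on with
  | C c => simpa using contDiff_const
  | add p q hp hq => simpa using hp.add hq
  | mul_X p j hp => simpa using hp.mul (by fun_prop)

lemma polyDirDeriv_eq_fderiv (n : EuclideanSpace ℝ (Fin d)) (p : MvPolynomial (Fin d) ℝ)
    (x : EuclideanSpace ℝ (Fin d)) : polyDirDeriv n p x =
      fderiv ℝ (fun x : EuclideanSpace ℝ (Fin d) => MvPolynomial.eval (fun i => x i) p) x n := by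
  rw [(MvPolynomial.hasFDerivAt_eval p x).fderiv, polyDirDeriv]
  simp [mul_comm]

lemma polyDirDeriv_single (i : Fin d) (p : MvPolynomial (Fin d) ℝ)
    (x : EuclideanSpace ℝ (Fin d)) : polyDirDeriv (EuclideanSpace.single i 1) p x =
      MvPolynomial.eval (fun j => x j) (MvPolynomial.pderiv i p) := by
  simp [polyDirDeriv]

/-- The three normal forms are proved together because multiplication by a variable turns each into
the next. -/
lemma MvPolynomial.exists_quadratic_aux {n : ℕ} {p : MvPolynomial (Fin d) ℝ}
    (hp : p.totalDegree ≤ n) :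
    (n = 0 → ∃ c, ∀ x : EuclideanSpace ℝ (Fin d), eval (fun i => x i) p = c) ∧
    (n = 1 → ∃ (c : ℝ) (l : EuclideanSpace ℝ (Fin d) →ₗ[ℝ] ℝ),
      ∀ x : EuclideanSpace ℝ (Fin d), eval (fun i => x i) p = l x + c) ∧
    (n = 2 → ∃ (c : ℝ) (l : EuclideanSpace ℝ (Fin d) →ₗ[ℝ] ℝ)
      (B : EuclideanSpace ℝ (Fin d) →ₗ[ℝ] EuclideanSpace ℝ (Fin d) →ₗ[ℝ] ℝ),
      ∀ x : EuclideanSpace ℝ (Fin d), eval (fun i => x i) p = B x x + l x + c) := by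
  let coordL : Fin d → EuclideanSpace ℝ (Fin d) →ₗ[ℝ] ℝ := fun i =>
    (EuclideanSpace.proj i : EuclideanSpace ℝ (Fin d) →L[ℝ] ℝ)
  refine induction_on_totalDegree_le (M := fun n p =>
    (n = 0 → ∃ c, ∀ x : EuclideanSpace ℝ (Fin d), eval (fun i => x i) p = c) ∧
    (n = 1 → ∃ (c : ℝ) (l : EuclideanSpace ℝ (Fin d) →ₗ[ℝ] ℝ),
      ∀ x : EuclideanSpace ℝ (Fin d), eval (fun i => x i) p = l x + c) ∧
    (n = 2 → ∃ (c : ℝ) (l : EuclideanSpace ℝ (Fin d) →ₗ[ℝ] ℝ)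
      (B : EuclideanSpace ℝ (Fin d) →ₗ[ℝ] EuclideanSpace ℝ (Fin d) →ₗ[ℝ] ℝ),
      ∀ x : EuclideanSpace ℝ (Fin d), eval (fun i => x i) p = B x x + l x + c)) ?_ ?_ ?_ hp
  · exact fun n c => ⟨fun _ => ⟨c, by simp⟩, fun _ => ⟨c, 0, by simp⟩, fun _ => ⟨c, 0, 0, by simp⟩⟩
  · rintro n p q ⟨p0, p1, p2⟩ ⟨q0, q1, q2⟩
    refine ⟨fun h => ?_, fun h => ?_, fun h => ?_⟩
    · obtain ⟨c, hc⟩ := p0 h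
      obtain ⟨c', hc'⟩ := q0 h
      exact ⟨c + c', fun x => by rw [map_add, hc, hc']⟩
    · obtain ⟨c, l, hc⟩ := p1 h
      obtain ⟨c', l', hc'⟩ := q1 h
      exact ⟨c + c', l + l', fun x => by rw [map_add, hc, hc', LinearMap.add_apply]; ring⟩
    · obtain ⟨c, l, B, hc⟩ := p2 h
      obtain ⟨c', l', B', hc'⟩ := q2 h
      exact ⟨c + c', l + l', B + B', fun x => by
        rw [map_add, hc, hc', LinearMap.add_apply, LinearMap.add_apply, LinearMap.add_apply]; ring⟩
  · rintro n p i ⟨p0, p1, -⟩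
    refine ⟨fun h => by omega, fun h => ?_, fun h => ?_⟩
    · obtain ⟨c, hc⟩ := p0 (by omega)
      exact ⟨0, c • coordL i, fun x => by simp [hc, coordL]⟩
    · obtain ⟨c, l, hc⟩ := p1 (by omega)
      refine ⟨0, c • coordL i, l.smulRight (coordL i), fun x => ?_⟩
      simp [hc, coordL]; ring

lemma MvPolynomial.exists_affineMap_of_totalDegree_le_one {p : MvPolynomial (Fin d) ℝ}
    (hp : p.totalDegree ≤ 1) : ∃ f : EuclideanSpace ℝ (Fin d) →ᵃ[ℝ] ℝ,
      ∀ x : EuclideanSpace ℝ (Fin d), eval (fun i => x i) p = f x := by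
  obtain ⟨c, l, h⟩ := (exists_quadratic_aux hp).2.1 rfl
  exact ⟨l.toAffineMap + AffineMap.const ℝ _ c, fun x => by simp [h]⟩

lemma MvPolynomial.exists_quadratic_of_totalDegree_le_two {p : MvPolynomial (Fin d) ℝ}
    (hp : p.totalDegree ≤ 2) : ∃ (c : ℝ) (l : EuclideanSpace ℝ (Fin d) →ₗ[ℝ] ℝ)
      (B : EuclideanSpace ℝ (Fin d) →ₗ[ℝ] EuclideanSpace ℝ (Fin d) →ₗ[ℝ] ℝ),
      (∀ x : EuclideanSpace ℝ (Fin d), eval (fun i => x i) p = B x x + l x + c) ∧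
      ∀ n x, polyDirDeriv n p x = B x n + B n x + l n := by
  obtain ⟨c, l, B, h⟩ := (exists_quadratic_aux hp).2.2 rfl
  refine ⟨c, l, B, h, fun n x => ?_⟩
  -- The polynomial is expanded along the line `x + t • n` and its derivative at `t = 0` computed in
  -- two ways. `B` need not be symmetric, hence the two terms `B x n` and `B n x`.
  have h1 : HasDerivAt (fun t : ℝ => eval (fun i => (x + t • n) i) p)
      (polyDirDeriv n p x) 0 := by
    rw [polyDirDeriv_eq_fderiv]
    have hg : HasDerivAt (fun t : ℝ => x + t • n) n 0 := by
      simpa using ((hasDerivAt_id (0 : ℝ)).smul_const n).const_add x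
    have hf := ((contDiff_eval p).differentiable one_ne_zero (x + (0 : ℝ) • n)).hasFDerivAt
    have := hf.comp_hasDerivAt 0 hg
    simp only [zero_smul, add_zero] at this
    exact this
  have h2 : (fun t : ℝ => eval (fun i => (x + t • n) i) p) = fun t =>
      (B x x + l x + c) + t * (B x n + B n x + l n) + t ^ 2 * B n n := by
    ext t
    rw [h]
    simp only [map_add, map_smul, LinearMap.add_apply, LinearMap.smul_apply, smul_eq_mul]
    ring
  rw [h2] at h1
  refine h1.unique ?_
  have h3 := (((hasDerivAt_id (0 : ℝ)).mul_const (B x n + B n x + l n)).const_add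
    (B x x + l x + c)).add ((hasDerivAt_pow 2 (0 : ℝ)).mul_const (B n n))
  exact h3.congr_deriv (by simp)

end Polynomial

/-! ### Averages over faces and edges in Hausdorff measure. -/

section HausdorffMeasure

variable {d : ℕ}

/-- The normalised measure `μHE[k]` is Lebesgue measure in dimension `k` and is transported by
isometries, so face integrals become volume integrals in the direction space of the face. -/
lemma Isometry.setIntegral_image_euclideanHausdorffMeasure {V : Type*} [NormedAddCommGroup V]
    [InnerProductSpace ℝ V] [FiniteDimensional ℝ V] [MeasurableSpace V] [BorelSpace V]
    {ι : V → EuclideanSpace ℝ (Fin d)} (hι : Isometry ι) {k : ℕ} (hk : Module.finrank ℝ V = k)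
    (K : Set V) (f : EuclideanSpace ℝ (Fin d) → ℝ) :
    ∫ x in ι '' K, f x ∂μHE[k] = ∫ y in K, f (ι y) := by
  have h1 : (volume : Measure V).map ι = (μHE[k]).restrict (Set.range ι) := by
    rw [← hι.map_euclideanHausdorffMeasure, ← hk, InnerProductSpace.euclideanHausdorffMeasure_eq_volume]
  have hemb : MeasurableEmbedding ι := hι.isClosedEmbedding.measurableEmbedding
  have h2 := hemb.setIntegral_map (μ := (volume : Measure V)) f (ι '' K)
  rw [h1, Set.preimage_image_eq _ hι.injective, Measure.restrict_restrict_of_subset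
    (Set.image_subset_range _ _)] at h2
  exact h2

/-- The mean value of an affine function over a simplex is the mean of its vertex values. -/
lemma AffineIndependent.exists_setIntegral_simplexHull {F : Finset (EuclideanSpace ℝ (Fin d))}
    (hF : AffineIndependent ℝ ((↑) : F → EuclideanSpace ℝ (Fin d))) {k : ℕ} (hk : F.card = k + 1) :
    ∃ m : ℝ, 0 < m ∧ ∀ f : EuclideanSpace ℝ (Fin d) →ᵃ[ℝ] ℝ,
      ∫ x in simplexHull F, f x ∂μHE[k] = m * ∑ q ∈ F, f q := by
  obtain ⟨p, hp⟩ : F.Nonempty := Finset.card_pos.1 (by omega)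
  set W := vectorSpan ℝ (Set.range ((↑) : F → EuclideanSpace ℝ (Fin d))) with hW
  have hfin : Module.finrank ℝ W = k := hF.finrank_vectorSpan (by simpa using hk)
  -- The direction space of the face, translated to the vertex `p`, parametrises its affine span
  -- isometrically; the vertices become an affine basis of `W`.
  let ι : W →ᵃ[ℝ] EuclideanSpace ℝ (Fin d) :=
    W.subtype.toAffineMap + AffineMap.const ℝ W p
  have hιa : ∀ w : W, ι w = w + p := fun w => rfl
  have hι : Isometry ι := by
    refine Isometry.of_dist_eq fun x y => ?_
    simp only [hιa, dist_add_right]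
    rfl
  let b₀ : F → W := fun q => ⟨q - p, vsub_mem_vectorSpan ℝ ⟨q, rfl⟩ ⟨⟨p, hp⟩, rfl⟩⟩
  have hb₀ : ι ∘ b₀ = ((↑) : F → EuclideanSpace ℝ (Fin d)) := by
    ext1 q; simp [hιa, b₀]
  have hind : AffineIndependent ℝ b₀ := by
    refine AffineIndependent.of_comp ι ?_
    rwa [hb₀]
  let b : AffineBasis F ℝ W := ⟨b₀, hind, by
    rw [hind.affineSpan_eq_top_iff_card_eq_finrank_add_one, hfin]; simpa using hk⟩
  have hbb : ∀ q, ι (b q) = q := fun q => congrFun hb₀ q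
  have hhull : simplexHull F = ι '' convexHull ℝ (Set.range b) := by
    rw [AffineMap.image_convexHull, ← Set.range_comp]
    have : (ι ∘ b) = ((↑) : F → EuclideanSpace ℝ (Fin d)) := hb₀
    rw [this, Subtype.range_coe]; rfl
  refine ⟨volume.real (convexHull ℝ (Set.range b)) / Fintype.card F,
    div_pos (b.measure_convexHull_pos volume) (by simp [hk]; positivity), fun f => ?_⟩
  rw [hhull, hι.setIntegral_image_euclideanHausdorffMeasure hfin]
  have := b.setIntegral_affineMap volume (f.comp ι)
  simp only [AffineMap.comp_apply, hbb] at this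
  rw [this]
  congr 1
  exact Finset.sum_coe_sort F (fun q => f q)

lemma AffineIndependent.setAverage_simplexHull {F : Finset (EuclideanSpace ℝ (Fin d))}
    (hF : AffineIndependent ℝ ((↑) : F → EuclideanSpace ℝ (Fin d))) {k : ℕ} (hk : F.card = k + 1)
    (f : EuclideanSpace ℝ (Fin d) →ᵃ[ℝ] ℝ) :
    ⨍ x in simplexHull F, f x ∂μHE[k] = (∑ q ∈ F, f q) / F.card := by
  obtain ⟨m, hm, h⟩ := hF.exists_setIntegral_simplexHull hk
  -- The constant `1` identifies the measure of the face as `m` times the number of vertices.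
  have h1 := h (AffineMap.const ℝ _ 1)
  simp at h1
  have hc : (0 : ℝ) < F.card := by rw [hk]; positivity
  rw [setAverage_eq, h f, h1, smul_eq_mul]
  field_simp

lemma setAverage_simplexHull_singleton (p : EuclideanSpace ℝ (Fin d))
    (f : EuclideanSpace ℝ (Fin d) → ℝ) :
    ⨍ x in simplexHull {p}, f x ∂μHE[0] = f p := by
  have hF : AffineIndependent ℝ ((↑) : ({p} : Finset (EuclideanSpace ℝ (Fin d))) →
      EuclideanSpace ℝ (Fin d)) := by
    have : Subsingleton ({p} : Finset (EuclideanSpace ℝ (Fin d))) :=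
      ⟨fun a b => Subtype.ext ((Finset.mem_singleton.1 a.2).trans (Finset.mem_singleton.1 b.2).symm)⟩
    exact affineIndependent_of_subsingleton ℝ _
  have h := hF.setAverage_simplexHull (k := 0) (by simp) (AffineMap.const ℝ _ (f p))
  simp only [Finset.sum_singleton, AffineMap.const_apply, Finset.card_singleton, Nat.cast_one,
    div_one] at h
  rw [← h, setAverage_eq, setAverage_eq]
  have hs : simplexHull {p} = {p} := by simp [simplexHull]
  congr 1
  refine setIntegral_congr_fun (by rw [hs]; exact measurableSet_singleton p) fun x hx => ?_
  rw [hs] at hx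
  rw [Set.mem_singleton_iff.1 hx]

/-- Simpson's rule on a segment. -/
lemma setAverage_simplexHull_pair [DecidableEq (EuclideanSpace ℝ (Fin d))]
    {p q : EuclideanSpace ℝ (Fin d)} (hpq : p ≠ q)
    (B : EuclideanSpace ℝ (Fin d) →ₗ[ℝ] EuclideanSpace ℝ (Fin d) →ₗ[ℝ] ℝ)
    (l : EuclideanSpace ℝ (Fin d) →ₗ[ℝ] ℝ) (c : ℝ) :
    ⨍ x in simplexHull {p, q}, (B x x + l x + c) ∂μHE[1] =
      (B p p + B q q) / 3 + (B p q + B q p) / 6 + (l p + l q) / 2 + c := by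
  set L := ‖q - p‖ with hL
  have hL0 : 0 < L := norm_pos_iff.2 (sub_ne_zero.2 hpq.symm)
  set u : EuclideanSpace ℝ (Fin d) := L⁻¹ • (q - p) with hu
  have hu1 : ‖u‖ = 1 := norm_smul_inv_norm (sub_ne_zero.2 hpq.symm)
  -- Parametrisation by arc length, which is an isometry because `u` is a unit vector.
  let ι : ℝ → EuclideanSpace ℝ (Fin d) := fun t => p + t • u
  have hι : Isometry ι := Isometry.of_dist_eq fun s t => by
    simp [ι, dist_eq_norm, ← sub_smul, norm_smul, hu1]
  have hq : q = p + L • u := by rw [hu, smul_smul, mul_inv_cancel₀ hL0.ne', one_smul]; abel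
  have hhull : simplexHull {p, q} = ι '' Set.Icc 0 L := by
    have h1 : (Set.Icc 0 L : Set ℝ) = segment ℝ 0 L := (segment_eq_Icc hL0.le).symm
    rw [simplexHull, Finset.coe_pair, convexHull_pair, segment_eq_image', h1, segment_eq_image',
      Set.image_image]
    refine Set.image_congr fun t _ => ?_
    simp only [ι, hu, smul_smul, sub_zero, zero_add, smul_eq_mul]
    rw [mul_assoc, mul_inv_cancel₀ hL0.ne', mul_one]
  have hint : ∀ f : EuclideanSpace ℝ (Fin d) → ℝ, ∫ x in simplexHull {p, q}, f x ∂μHE[1] =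
      ∫ t in (0 : ℝ)..L, f (ι t) := fun f => by
    rw [hhull, hι.setIntegral_image_euclideanHausdorffMeasure (by simp),
      intervalIntegral.integral_of_le hL0.le, integral_Icc_eq_integral_Ioc]
  have h1 : (μHE[1]).real (simplexHull {p, q}) = L := by
    have := hint fun _ => 1
    simpa using this
  have h2 : ∀ t, B (ι t) (ι t) + l (ι t) + c =
      (B p p + l p + c) + t * (B p u + B u p + l u) + t ^ 2 * B u u := fun t => by
    simp only [ι, map_add, map_smul, LinearMap.add_apply, LinearMap.smul_apply, smul_eq_mul]
    ring
  rw [setAverage_eq, hint, h1]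
  simp_rw [h2]
  rw [intervalIntegral.integral_add, intervalIntegral.integral_add,
    intervalIntegral.integral_mul_const, intervalIntegral.integral_mul_const, integral_id,
    integral_pow, intervalIntegral.integral_const, hq]
  · simp only [map_add, map_smul, LinearMap.add_apply, LinearMap.smul_apply, smul_eq_mul]
    field_simp
    ring
  all_goals exact Continuous.intervalIntegrable (by fun_prop) _ _

end HausdorffMeasure

/-! ### From single functions to Crouzeix-Raviart and `H10` on the mesh. -/

section Mesh

variable {d : ℕ} {Ω : Set (EuclideanSpace ℝ (Fin d))}
  {𝒯 : Finset (Finset (EuclideanSpace ℝ (Fin d)))}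
  {T T' : Finset (EuclideanSpace ℝ (Fin d))} {p p' q x : EuclideanSpace ℝ (Fin d)}

lemma IsPolyhedralDomain.volume_frontier (hΩ : IsPolyhedralDomain Ω) : volume (frontier Ω) = 0 := by
  obtain ⟨s, hs, hsub⟩ := hΩ.frontier_subset
  refine measure_mono_null hsub ((measure_biUnion_null_iff s.countable_toSet).2 fun q hq => ?_)
  by_cases hne : ∃ y, inner ℝ q.1 y = q.2
  · obtain ⟨y, hy⟩ := hne
    let A : AffineSubspace ℝ (EuclideanSpace ℝ (Fin d)) :=
      AffineSubspace.mk' y (LinearMap.ker (innerSL ℝ q.1 : _ →ₗ[ℝ] ℝ))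
    have hA : {x | inner ℝ q.1 x = q.2} = (A : Set (EuclideanSpace ℝ (Fin d))) := by
      ext x
      simp [A, AffineSubspace.mem_mk', inner_sub_right, hy, sub_eq_zero]
    rw [hA]
    refine Measure.addHaar_affineSubspace volume A fun htop => hs q hq ?_
    have hmem : y + q.1 ∈ A := htop ▸ AffineSubspace.mem_top ℝ _ _
    simpa [A, AffineSubspace.mem_mk'] using hmem
  · push Not at hne
    have : {x | inner ℝ q.1 x = q.2} = ∅ := Set.eq_empty_of_forall_notMem hne
    rw [this, measure_empty]

lemma restrict_interior_simplexHull (T : Finset (EuclideanSpace ℝ (Fin d))) :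
    (volume.restrict (interior (simplexHull T)) : Measure (EuclideanSpace ℝ (Fin d))) =
      volume.restrict (simplexHull T) :=
  Measure.restrict_congr_set (interior_ae_eq_of_null_frontier
    ((convex_convexHull ℝ _).addHaar_frontier volume))

lemma isBounded_interior_simplexHull (T : Finset (EuclideanSpace ℝ (Fin d))) :
    Bornology.IsBounded (interior (simplexHull T)) :=
  (IsConformingMesh.isCompact_simplexHull (T := T)).isBounded.subset interior_subset

namespace IsConformingMesh

/-- An element is only known to lie in `closure Ω`; since the boundary lies in finitely many
hyperplanes it is null, so norms over elements are bounded by norms over `Ω`. -/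
lemma restrict_interior_le (h : IsConformingMesh Ω 𝒯) (hΩ : IsPolyhedralDomain Ω) (hT : T ∈ 𝒯) :
    (volume.restrict (interior (simplexHull T)) : Measure (EuclideanSpace ℝ (Fin d))) ≤
      volume.restrict Ω := by
  have h1 : (volume.restrict Ω : Measure (EuclideanSpace ℝ (Fin d))) =
      volume.restrict (closure Ω) :=
    Measure.restrict_congr_set (closure_ae_eq_of_null_frontier hΩ.volume_frontier).symm
  rw [h1, restrict_interior_simplexHull]
  refine Measure.restrict_mono ?_ le_rfl
  rw [← h.cover]
  exact Set.subset_biUnion_of_mem (u := fun T => simplexHull T) hT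

lemma memLp_two_of_forall (h : IsConformingMesh Ω 𝒯) {f : EuclideanSpace ℝ (Fin d) → ℝ}
    (hf : ∀ T ∈ 𝒯, MemLp f 2 (volume.restrict (interior (simplexHull T)))) :
    MemLp f 2 (volume.restrict Ω) := by
  refine MemLp.mono_measure (Measure.restrict_mono subset_closure le_rfl)
    (?_ : MemLp f 2 (volume.restrict (closure Ω)))
  have hf' : ∀ T ∈ 𝒯, MemLp f 2 (volume.restrict (simplexHull T)) := fun T hT => by
    rw [← restrict_interior_simplexHull]; exact hf T hT
  have hm : AEStronglyMeasurable f (volume.restrict (⋃ T ∈ 𝒯, simplexHull T)) := by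
    rw [← Finset.set_biUnion_coe, Set.biUnion_eq_iUnion, aestronglyMeasurable_iUnion_iff]
    exact fun T => (hf' T T.2).1
  rw [← h.cover, memLp_two_iff_integrable_sq hm]
  exact integrableOn_finset_iUnion.2 fun T hT => (memLp_two_iff_integrable_sq (hf' T hT).1).1 (hf' T hT)

lemma sum_indicator_apply (h : IsConformingMesh Ω 𝒯) {F : Type*} [AddCommMonoid F]
    (g : Finset (EuclideanSpace ℝ (Fin d)) → EuclideanSpace ℝ (Fin d) → F) (hT : T ∈ 𝒯)
    (hx : x ∈ interior (simplexHull T)) :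
    ∑ T ∈ 𝒯, (interior (simplexHull T)).indicator (g T) x = g T x := by
  rw [Finset.sum_eq_single_of_mem T hT, Set.indicator_of_mem hx]
  intro T' hT' hne
  exact Set.indicator_of_notMem
    (fun hx' => (Set.disjoint_left.1 (h.disjoint_interior hT' hT hne)) hx' hx) _

/-- The interiors of distinct elements are disjoint, so the local gradients glue into one function.
-/
lemma exists_hasBrokenGradient (h : IsConformingMesh Ω 𝒯) {f : EuclideanSpace ℝ (Fin d) → ℝ}
    {g : Finset (EuclideanSpace ℝ (Fin d)) → EuclideanSpace ℝ (Fin d) → EuclideanSpace ℝ (Fin d)}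
    (hg : ∀ T ∈ 𝒯, HasWeakGradient (interior (simplexHull T)) f (g T)) :
    ∃ G, HasBrokenGradient 𝒯 f G :=
  ⟨fun x => ∑ T ∈ 𝒯, (interior (simplexHull T)).indicator (g T) x, fun T hT =>
    (hg T hT).congr (ae_eq_refl _) ((ae_restrict_iff' isOpen_interior.measurableSet).2
      (ae_of_all _ fun _ hx => (h.sum_indicator_apply g hT hx).symm))⟩

lemma exists_hasBrokenDivergence (h : IsConformingMesh Ω 𝒯)
    {v : EuclideanSpace ℝ (Fin d) → EuclideanSpace ℝ (Fin d)}
    {g : Finset (EuclideanSpace ℝ (Fin d)) → EuclideanSpace ℝ (Fin d) → ℝ}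
    (hg : ∀ T ∈ 𝒯, HasWeakDivergence (interior (simplexHull T)) v (g T)) :
    ∃ D, HasBrokenDivergence 𝒯 v D :=
  ⟨fun x => ∑ T ∈ 𝒯, (interior (simplexHull T)).indicator (g T) x, fun T hT =>
    (hg T hT).congr (ae_eq_refl _) ((ae_restrict_iff' isOpen_interior.measurableSet).2
      (ae_of_all _ fun _ hx => (h.sum_indicator_apply g hT hx).symm))⟩

variable [DecidableEq (EuclideanSpace ℝ (Fin d))]

lemma affineIndependent_erase (h : IsConformingMesh Ω 𝒯) (hT : T ∈ 𝒯) (p) :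
    AffineIndependent ℝ ((↑) : ↥(T.erase p) → EuclideanSpace ℝ (Fin d)) :=
  (h.affineIndependent T hT).mono (Finset.coe_subset.2 (Finset.erase_subset p T))

lemma coneFlux_affineMap (h : IsConformingMesh Ω 𝒯) (hT : T ∈ 𝒯) (hp : p ∈ T)
    (f : EuclideanSpace ℝ (Fin d) →ᵃ[ℝ] ℝ) :
    coneFlux volume (simplexHull T) p f =
      volume.real (simplexHull T) * ∑ q ∈ T.erase p, f q := by
  have := coneFlux_affine volume (h.basis hT) ⟨p, hp⟩ f
  rw [← h.simplexHull_eq hT] at this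
  refine this.trans ?_
  congr 1
  refine Finset.sum_bij (fun q _ => (q : EuclideanSpace ℝ (Fin d))) ?_ ?_ ?_ ?_
  · rintro ⟨q, hq⟩ hqp
    exact Finset.mem_erase.2 ⟨fun e => (Finset.mem_erase.1 hqp).1 (Subtype.ext e), hq⟩
  · exact fun _ _ _ _ => Subtype.ext
  · intro q hq
    have hq := Finset.mem_erase.1 hq
    exact ⟨⟨q, hq.2⟩, Finset.mem_erase.2 ⟨fun e => hq.1 (congrArg Subtype.val e), Finset.mem_univ _⟩,
      rfl⟩
  · exact fun _ _ => rfl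

/-- The elementwise divergence theorem for a Raviart--Thomas field and a Crouzeix--Raviart
function. -/
lemma sum_setIntegral_polynomial_eq_zero (h : IsConformingMesh Ω 𝒯) (hΩ : IsOpen Ω) (hd : 1 ≤ d)
    {a : Finset (EuclideanSpace ℝ (Fin d)) → EuclideanSpace ℝ (Fin d)}
    {β : Finset (EuclideanSpace ℝ (Fin d)) → ℝ}
    (hn : ∀ F T₁ T₂, IsInteriorFace Ω 𝒯 F T₁ T₂ → ∀ n, IsUnitNormal F n → ∀ x ∈ simplexHull F,
      inner ℝ (a T₁ + β T₁ • x) n - inner ℝ (a T₂ + β T₂ • x) n = 0)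
    {P : Finset (EuclideanSpace ℝ (Fin d)) → MvPolynomial (Fin d) ℝ}
    (hP : ∀ T ∈ 𝒯, (P T).totalDegree ≤ 1)
    (hint : ∀ F T₁ T₂, IsInteriorFace Ω 𝒯 F T₁ T₂ →
      ∫ x in simplexHull F, (MvPolynomial.eval (fun i => x i) (P T₁) -
        MvPolynomial.eval (fun i => x i) (P T₂)) ∂μHE[d - 1] = 0)
    (hbd : ∀ F T, IsBoundaryFace Ω 𝒯 F T →
      ∫ x in simplexHull F, MvPolynomial.eval (fun i => x i) (P T) ∂μHE[d - 1] = 0) :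
    ∑ T ∈ 𝒯, ∫ x in simplexHull T,
      (fderiv ℝ (fun x : EuclideanSpace ℝ (Fin d) => MvPolynomial.eval (fun i => x i) (P T)) x
        (a T + β T • x) + d * β T * MvPolynomial.eval (fun i => x i) (P T)) = 0 := by
  refine h.sum_setIntegral_eq_zero hΩ hd hn
    (g := fun T (x : EuclideanSpace ℝ (Fin d)) => MvPolynomial.eval (fun i => x i) (P T))
    (fun T _ => (P T).contDiff_eval) ?_ ?_
  · intro T₁ T₂ p hp hF
    obtain ⟨f₁, h₁⟩ := MvPolynomial.exists_affineMap_of_totalDegree_le_one (hP T₁ hF.left_mem)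
    obtain ⟨f₂, h₂⟩ := MvPolynomial.exists_affineMap_of_totalDegree_le_one (hP T₂ hF.right_mem)
    obtain ⟨m, hm, hmf⟩ := (h.affineIndependent_erase hF.left_mem p).exists_setIntegral_simplexHull
      hF.left.2
    have h0 := hint _ T₁ T₂ hF
    simp_rw [h₁, h₂] at h0 ⊢
    have h3 := hmf (f₁ - f₂)
    simp only [AffineMap.coe_sub, Pi.sub_apply] at h3
    rw [h3] at h0
    have h4 := h.coneFlux_affineMap hF.left_mem hp (f₁ - f₂)
    simp only [AffineMap.coe_sub, Pi.sub_apply] at h4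
    -- The face integral is a nonzero multiple of the vertex sum over the face, and the flux is a
    -- multiple of the same sum.
    rw [(mul_eq_zero.1 h0).resolve_left hm.ne', mul_zero] at h4
    exact h4
  · intro T p hp hF
    obtain ⟨f, hf⟩ := MvPolynomial.exists_affineMap_of_totalDegree_le_one (hP T hF.mem)
    obtain ⟨m, hm, hmf⟩ := (h.affineIndependent_erase hF.mem p).exists_setIntegral_simplexHull
      hF.face.2
    have h0 := hbd _ T hF
    simp_rw [hf] at h0 ⊢
    rw [hmf f] at h0
    have h4 := h.coneFlux_affineMap hF.mem hp f
    rw [(mul_eq_zero.1 h0).resolve_left hm.ne', mul_zero] at h4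
    exact h4

/-- A single smooth function has no jumps, and its support lies in the open set `Ω`, away from the
boundary faces. -/
lemma sum_setIntegral_testFunction_eq_zero (h : IsConformingMesh Ω 𝒯) (hΩ : IsOpen Ω) (hd : 1 ≤ d)
    {a : Finset (EuclideanSpace ℝ (Fin d)) → EuclideanSpace ℝ (Fin d)}
    {β : Finset (EuclideanSpace ℝ (Fin d)) → ℝ}
    (hn : ∀ F T₁ T₂, IsInteriorFace Ω 𝒯 F T₁ T₂ → ∀ n, IsUnitNormal F n → ∀ x ∈ simplexHull F,
      inner ℝ (a T₁ + β T₁ • x) n - inner ℝ (a T₂ + β T₂ • x) n = 0)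
    {η : EuclideanSpace ℝ (Fin d) → ℝ} (hη : IsTestFunction Ω η) :
    ∑ T ∈ 𝒯, ∫ x in simplexHull T, (fderiv ℝ η x (a T + β T • x) + d * β T * η x) = 0 := by
  have hη1 : ContDiff ℝ 1 η := hη.1.of_le (by simp)
  refine h.sum_setIntegral_eq_zero hΩ hd hn (g := fun _ => η) (fun _ _ => hη1) ?_ ?_
  · intro T₁ T₂ p hp hF
    rw [coneFlux_sub volume isCompact_simplexHull p hη1 hη1, sub_self]
  · intro T p hp hF
    rw [h.simplexHull_eq hF.mem]
    refine coneFlux_eq_zero volume (h.basis hF.mem) ⟨p, hp⟩ hη1 fun x hx hx0 => ?_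
    rw [← h.simplexHull_eq hF.mem] at hx
    have hxF := hF.boundary ((h.mem_simplexHull_erase_iff hF.mem hp).2 ⟨hx, hx0⟩)
    by_contra hne
    have := hη.2.2 (subset_tsupport η hne)
    rw [frontier, hΩ.interior_eq] at hxF
    exact hxF.2 this

/-- The elementwise divergence theorem for a Raviart--Thomas field and an `H₀¹` function. -/
lemma sum_setIntegral_H10_eq_zero (h : IsConformingMesh Ω 𝒯) (hΩ : IsPolyhedralDomain Ω)
    (hd : 1 ≤ d) {a : Finset (EuclideanSpace ℝ (Fin d)) → EuclideanSpace ℝ (Fin d)}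
    {β : Finset (EuclideanSpace ℝ (Fin d)) → ℝ}
    (hn : ∀ F T₁ T₂, IsInteriorFace Ω 𝒯 F T₁ T₂ → ∀ n, IsUnitNormal F n → ∀ x ∈ simplexHull F,
      inner ℝ (a T₁ + β T₁ • x) n - inner ℝ (a T₂ + β T₂ • x) n = 0)
    {w : EuclideanSpace ℝ (Fin d) → ℝ} (hw : w ∈ H10 Ω) :
    ∃ G, (∀ T ∈ 𝒯, HasWeakGradient (interior (simplexHull T)) w G) ∧
      ∑ T ∈ 𝒯, ((∫ x in interior (simplexHull T), inner ℝ (a T + β T • x) (G x)) +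
        ∫ x in interior (simplexHull T), d * β T * w x) = 0 := by
  obtain ⟨G, hG, η, hη, hlim, hlimG⟩ := hw
  have hle := fun T (hT : T ∈ 𝒯) => h.restrict_interior_le hΩ hT
  have hlimT : ∀ T ∈ 𝒯, Tendsto (fun k => eLpNorm (fun x => η k x - w x) 2
      (volume.restrict (interior (simplexHull T)))) atTop (𝓝 0) := fun T hT =>
    tendsto_of_tendsto_of_tendsto_of_le_of_le tendsto_const_nhds hlim (fun _ => zero_le)
      fun k => eLpNorm_mono_measure _ (hle T hT)
  have hlimGT : ∀ T ∈ 𝒯, Tendsto (fun k => eLpNorm (fun x => gradient (η k) x - G x) 2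
      (volume.restrict (interior (simplexHull T)))) atTop (𝓝 0) := fun T hT =>
    tendsto_of_tendsto_of_tendsto_of_le_of_le tendsto_const_nhds hlimG (fun _ => zero_le)
      fun k => eLpNorm_mono_measure _ (hle T hT)
  have hb := fun T => isBounded_interior_simplexHull (d := d) T
  have hwT := fun T hT => hG.memLp.mono_measure (hle T hT)
  have hGT := fun T hT => hG.memLp_gradient.mono_measure (hle T hT)
  -- The interior of an element may leave `Ω`, for instance across a slit, so the weak gradient on
  -- `Ω` is not simply restricted. The approximating test functions are smooth on the whole space
  -- and give it in the limit.
  refine ⟨G, fun T hT => HasWeakGradient.of_tendsto (hb T) (hwT T hT) (hGT T hT) hη (hlimT T hT)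
    (hlimGT T hT), ?_⟩
  have hconv : Tendsto (fun k => ∑ T ∈ 𝒯,
      ((∫ x in interior (simplexHull T), inner ℝ (a T + β T • x) (gradient (η k) x)) +
        ∫ x in interior (simplexHull T), d * β T * η k x)) atTop
      (𝓝 (∑ T ∈ 𝒯, ((∫ x in interior (simplexHull T), inner ℝ (a T + β T • x) (G x)) +
        ∫ x in interior (simplexHull T), d * β T * w x))) := by
    refine tendsto_finsetSum _ fun T hT => Tendsto.add ?_ ?_
    · exact tendsto_integral_inner_of_tendsto_eLpNorm
        (Continuous.memLp_restrict_of_isBounded (by fun_prop) (hb T) 2) (hGT T hT)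
        (fun k => (hη k).continuous_gradient.memLp_restrict_of_isBounded (hb T) 2) (hlimGT T hT)
    · have := tendsto_integral_inner_of_tendsto_eLpNorm
        (Continuous.memLp_restrict_of_isBounded (continuous_const (y := d * β T)) (hb T) 2)
        (hwT T hT) (fun k => (hη k).1.continuous.memLp_restrict_of_isBounded (hb T) 2) (hlimT T hT)
      simpa only [RCLike.inner_apply, conj_trivial, mul_comm] using this
  refine tendsto_nhds_unique hconv (tendsto_const_nhds.congr fun k => ?_)
  rw [← h.sum_setIntegral_testFunction_eq_zero hΩ.isOpen hd hn (hη k)]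
  refine Finset.sum_congr rfl fun T hT => ?_
  rw [← restrict_interior_simplexHull, ← integral_add]
  · congr 1
    ext x
    rw [inner_gradient_right, conj_trivial]
  · exact (Continuous.memLp_restrict_of_isBounded (by fun_prop) (hb T) 2).integrable_inner_two
      ((hη k).continuous_gradient.memLp_restrict_of_isBounded (hb T) 2)
  · exact (Continuous.memLp_restrict_of_isBounded (continuous_const (y := d * β T)) (hb T)
      2).integrable_mul_two ((hη k).1.continuous.memLp_restrict_of_isBounded (hb T) 2)

/-- A linear functional vanishing on the normal and the tangential directions of a face is zero. -/
lemma linearMap_eq_zero_of_normal_tangential (h : IsConformingMesh Ω 𝒯) (hT : T ∈ 𝒯) (hd : 1 ≤ d)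
    (hp : p ∈ T) (S : EuclideanSpace ℝ (Fin d) →L[ℝ] ℝ)
    (hN : ∀ n, IsUnitNormal (T.erase p) n → S n = 0)
    (ht : ∀ q ∈ T.erase p, ∀ r ∈ T.erase p, q ≠ r → S (q - r) = 0) : S = 0 := by
  set N := h.coordGradient hT hp with hNdef
  have hN0 : N ≠ 0 := h.coordGradient_ne_zero hT hd hp
  have hNn : ‖N‖ ≠ 0 := norm_ne_zero_iff.2 hN0
  have hSN : S N = 0 := by
    have := hN _ (h.isUnitNormal_coordGradient hT hd hp)
    rw [map_smul, smul_eq_mul] at this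
    exact (mul_eq_zero.1 this).resolve_left (inv_ne_zero hNn)
  obtain ⟨r, hr⟩ : (T.erase p).Nonempty := by
    rw [← Finset.card_pos, (h.isSubsimplex_erase hT hd hp).2]; omega
  have ht' : ∀ q ∈ T.erase p, S (q - r) = 0 := fun q hq => by
    by_cases hqr : q = r
    · rw [hqr, sub_self, map_zero]
    · exact ht q hq r hr hqr
  ext u
  -- The part of `u` orthogonal to `N`. Its expansion in the differences `q - r` below uses
  -- coordinate differences, which sum to zero, and the one belonging to `p` vanishes because `t` is
  -- tangential.
  set t := u - (inner ℝ N u / ‖N‖ ^ 2) • N with htdef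
  have hNt : inner ℝ N t = 0 := by
    rw [htdef, inner_sub_right, inner_smul_right, real_inner_self_eq_norm_sq]
    field_simp; ring
  have hpt : h.coord hT hp t = h.coord hT hp 0 := by
    have := h.inner_coordGradient hT hp t
    rw [← hNdef, hNt] at this
    have h2 := h.coord_linear_sub hT hp t 0
    rw [sub_zero, ← this] at h2
    linarith
  have hsum : t = ∑ q : T, ((h.basis hT).coord q t - (h.basis hT).coord q 0) •
      ((q : EuclideanSpace ℝ (Fin d)) - r) := by
    have e1 := (h.basis hT).linear_combination_coord_eq_self t
    have e2 := (h.basis hT).linear_combination_coord_eq_self (0 : EuclideanSpace ℝ (Fin d))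
    simp only [basis_apply] at e1 e2
    simp only [smul_sub, sub_smul, Finset.sum_sub_distrib, ← Finset.sum_smul, e1, e2,
      AffineBasis.sum_coord_apply_eq_one]
    simp
  have hSt : S t = 0 := by
    rw [hsum, map_sum]
    refine Finset.sum_eq_zero fun q _ => ?_
    rw [map_smul, smul_eq_mul]
    by_cases hqp : (q : EuclideanSpace ℝ (Fin d)) = p
    · have : q = ⟨p, hp⟩ := Subtype.ext hqp
      have h3 : (h.basis hT).coord q t - (h.basis hT).coord q 0 = 0 := by
        rw [this]; exact sub_eq_zero.2 hpt
      rw [h3, zero_mul]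
    · rw [ht' q (Finset.mem_erase.2 ⟨hqp, q.2⟩), mul_zero]
  have hu : u = t + (inner ℝ N u / ‖N‖ ^ 2) • N := by rw [htdef]; abel
  rw [hu, map_add, map_smul, hSt, hSN]; simp

end IsConformingMesh

/-- The tangential derivative of a quadratic polynomial, summed over the vertices of a face, is
determined by its mean values over the subsimplexes of codimension one in the face. -/
lemma sum_polyDirDeriv_sub [DecidableEq (EuclideanSpace ℝ (Fin d))] (hd : d = 2 ∨ d = 3)
    {F : Finset (EuclideanSpace ℝ (Fin d))} (hF : F.card = d) {q r : EuclideanSpace ℝ (Fin d)}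
    (hq : q ∈ F) (hr : r ∈ F) (hqr : q ≠ r) {P : MvPolynomial (Fin d) ℝ}
    (hP : P.totalDegree ≤ 2) :
    ∑ s ∈ F, polyDirDeriv (q - r) P s = d * (d - 1) *
      (⨍ x in simplexHull (F.erase r), MvPolynomial.eval (fun i => x i) P ∂μHE[d - 2] -
        ⨍ x in simplexHull (F.erase q), MvPolynomial.eval (fun i => x i) P ∂μHE[d - 2]) := by
  obtain ⟨c, l, B, h1, h2⟩ := MvPolynomial.exists_quadratic_of_totalDegree_le_two hP
  simp_rw [h1, h2]
  have hcard : (F \ {q, r}).card = d - 2 := by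
    rw [Finset.card_sdiff_of_subset (by simp [Finset.insert_subset_iff, hq, hr]), hF,
      Finset.card_pair hqr]
  rcases hd with hd | hd
  -- For `d = 2` the averages are vertex values, and the trapezoidal rule is exact for the affine
  -- derivative along the edge; the factor is `2`.
  · have hF' : F = {q, r} := by
      refine (Finset.sdiff_eq_empty_iff_subset.1 (Finset.card_eq_zero.1 (by omega))).antisymm
        (by simp [Finset.insert_subset_iff, hq, hr])
    have e1 : F.erase r = {q} := by rw [hF']; ext x; simp; grind
    have e2 : F.erase q = {r} := by rw [hF']; ext x; simp; grind
    have e3 : d - 2 = 0 := by omega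
    rw [e1, e2, e3, setAverage_simplexHull_singleton, setAverage_simplexHull_singleton, hF',
      Finset.sum_pair hqr]
    have hd' : (d : ℝ) = 2 := by exact_mod_cast hd
    rw [hd']
    simp only [map_sub, LinearMap.sub_apply]
    ring
  -- For `d = 3` the averages run over the two edges joining `q` and `r` to the third vertex `s`,
  -- and Simpson's rule evaluates them; the factor is `6`.
  · obtain ⟨s, hs⟩ := Finset.card_eq_one.1 (hcard.trans (by omega))
    have hsF : s ∈ F \ {q, r} := hs ▸ Finset.mem_singleton_self s
    simp only [Finset.mem_sdiff, Finset.mem_insert, Finset.mem_singleton, not_or] at hsF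
    have hF' : F = {q, r, s} := by
      have : F = {q, r} ∪ F \ {q, r} :=
        (Finset.union_sdiff_of_subset (by simp [Finset.insert_subset_iff, hq, hr])).symm
      rw [this, hs]; ext x; simp
    have e1 : F.erase r = {q, s} := by rw [hF']; ext x; simp; grind
    have e2 : F.erase q = {r, s} := by rw [hF']; ext x; simp; grind
    have e3 : d - 2 = 1 := by omega
    rw [e1, e2, e3, setAverage_simplexHull_pair (Ne.symm hsF.2.1),
      setAverage_simplexHull_pair (Ne.symm hsF.2.2), hF',
      Finset.sum_insert (by simp [hqr, Ne.symm hsF.2.1]), Finset.sum_pair (Ne.symm hsF.2.2)]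
    have hd' : (d : ℝ) = 3 := by exact_mod_cast hd
    rw [hd']
    simp only [map_sub, LinearMap.sub_apply]
    ring

lemma exists_affineMap_polyDirDeriv {P : MvPolynomial (Fin d) ℝ} (hP : P.totalDegree ≤ 2)
    (n : EuclideanSpace ℝ (Fin d)) :
    ∃ f : EuclideanSpace ℝ (Fin d) →ᵃ[ℝ] ℝ, ∀ x, polyDirDeriv n P x = f x := by
  obtain ⟨c, l, B, -, h2⟩ := MvPolynomial.exists_quadratic_of_totalDegree_le_two hP
  exact ⟨(B.flip n + B n).toAffineMap + AffineMap.const ℝ _ (l n), fun x => by simp [h2]⟩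

lemma zero_mem_H10 (Ω : Set (EuclideanSpace ℝ (Fin d))) : (0 : EuclideanSpace ℝ (Fin d) → ℝ) ∈ H10 Ω := by
  have hg : gradient (fun _ : EuclideanSpace ℝ (Fin d) => (0 : ℝ)) = fun _ => 0 := by
    ext1 x; simp [gradient]
  refine ⟨fun _ => 0, ⟨MemLp.zero, MemLp.zero, by simp⟩, fun _ _ => 0, fun _ => ⟨contDiff_const, ?_, ?_⟩,
    ?_, ?_⟩
  · exact HasCompactSupport.zero
  · simp [tsupport]
  · simp
  · simp [hg]

end Mesh

/-! ### Morley derivatives and the final integration by parts. -/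

section Mesh

variable {d : ℕ} {Ω : Set (EuclideanSpace ℝ (Fin d))}
  {𝒯 : Finset (Finset (EuclideanSpace ℝ (Fin d)))}
  {T T' : Finset (EuclideanSpace ℝ (Fin d))} {p p' q x : EuclideanSpace ℝ (Fin d)}

lemma IsPiecewisePolynomial.hasWeakGradient {m : ℕ} {f : EuclideanSpace ℝ (Fin d) → ℝ}
    {P : Finset (EuclideanSpace ℝ (Fin d)) → MvPolynomial (Fin d) ℝ}
    (hf : IsPiecewisePolynomial m Ω 𝒯 f P) (hT : T ∈ 𝒯) :
    HasWeakGradient (interior (simplexHull T)) f (gradient fun x : EuclideanSpace ℝ (Fin d) =>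
      MvPolynomial.eval (fun i => x i) (P T)) := by
  refine ((P T).contDiff_eval.hasWeakGradient (isBounded_interior_simplexHull T)).congr ?_
    (ae_eq_refl _)
  rw [restrict_interior_simplexHull]
  exact (hf.eq_poly T hT).mono fun x hx => hx.symm

/-- The vertex sum of the jump of the full gradient of a Morley function over a face vanishes. -/
lemma IsConformingMesh.sum_polyDirDeriv_eq_zero [DecidableEq (EuclideanSpace ℝ (Fin d))]
    (h : IsConformingMesh Ω 𝒯) (hT : T ∈ 𝒯) (hd : d = 2 ∨ d = 3) (hp : p ∈ T)
    {ι : Type*} (s : Finset ι) (w : ι → ℝ) (Q : ι → MvPolynomial (Fin d) ℝ)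
    (hQ : ∀ j ∈ s, (Q j).totalDegree ≤ 2)
    (hN : ∀ n, IsUnitNormal (T.erase p) n →
      ∑ j ∈ s, w j * ∑ q ∈ T.erase p, polyDirDeriv n (Q j) q = 0)
    (hS : ∀ S, IsSubsimplex (d - 2) S (T.erase p) →
      ∑ j ∈ s, w j * ⨍ x in simplexHull S, MvPolynomial.eval (fun i => x i) (Q j) ∂μHE[d - 2] = 0)
    (u : EuclideanSpace ℝ (Fin d)) :
    ∑ j ∈ s, w j * ∑ q ∈ T.erase p, polyDirDeriv u (Q j) q = 0 := by
  have hd1 : 1 ≤ d := by omega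
  have hcard : (T.erase p).card = d := by rw [(h.isSubsimplex_erase hT hd1 hp).2]; omega
  -- The quantity is linear in the direction, so normals and edge directions suffice. A weighted
  -- family of polynomials covers both the jump on an interior face and the one-sided value on a
  -- boundary face.
  let L : EuclideanSpace ℝ (Fin d) →L[ℝ] ℝ := ∑ j ∈ s, w j • ∑ q ∈ T.erase p,
    fderiv ℝ (fun x : EuclideanSpace ℝ (Fin d) => MvPolynomial.eval (fun i => x i) (Q j)) q
  have hL : ∀ u, L u = ∑ j ∈ s, w j * ∑ q ∈ T.erase p, polyDirDeriv u (Q j) q := fun u => by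
    simp [L, polyDirDeriv_eq_fderiv]
  have hL0 : L = 0 := by
    refine h.linearMap_eq_zero_of_normal_tangential hT hd1 hp L (fun n hn => ?_)
      (fun q hq r hr hqr => ?_)
    · rw [hL]; exact hN n hn
    · have hsub : ∀ r ∈ T.erase p, IsSubsimplex (d - 2) ((T.erase p).erase r) (T.erase p) :=
        fun r hr => ⟨Finset.erase_subset _ _, by rw [Finset.card_erase_of_mem hr, hcard]; omega⟩
      have h1 := hS _ (hsub r hr)
      have h2 := hS _ (hsub q hq)
      rw [hL, Finset.sum_congr rfl fun j hj => by
        rw [sum_polyDirDeriv_sub hd hcard hq hr hqr (hQ j hj)]]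
      simp only [mul_sub, Finset.sum_sub_distrib, mul_left_comm (w _), ← Finset.mul_sum]
      rw [h1, h2]; ring
  rw [← hL, hL0]; rfl

/-- The partial derivatives of a Morley function are Crouzeix--Raviart functions. -/
lemma Morley0Space.apply_mem_CR0Space (h : IsConformingMesh Ω 𝒯) (hd : d = 2 ∨ d = 3)
    {φ : EuclideanSpace ℝ (Fin d) → ℝ} (hφ : φ ∈ Morley0Space Ω 𝒯)
    {G : EuclideanSpace ℝ (Fin d) → EuclideanSpace ℝ (Fin d)} (hG : HasBrokenGradient 𝒯 φ G)
    (i : Fin d) : (fun x => G x i) ∈ CR0Space Ω 𝒯 := by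
  classical
  obtain ⟨P, hP, hnint, hSint, hnbd, hSbd⟩ := hφ
  have hd1 : 1 ≤ d := by omega
  have hface : ∀ {F T : Finset (EuclideanSpace ℝ (Fin d))}, T ∈ 𝒯 → IsSubsimplex (d - 1) F T →
      ∃ p ∈ T, F = T.erase p := by
    intro F T hT hF
    have h1 : (T \ F).card = 1 := by
      rw [Finset.card_sdiff_of_subset hF.1, hF.2, h.card_eq T hT]; omega
    obtain ⟨p, hp⟩ := Finset.card_eq_one.1 h1
    refine ⟨p, (Finset.mem_sdiff.1 (hp ▸ Finset.mem_singleton_self p)).1, ?_⟩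
    rw [← Finset.sdiff_singleton_eq_erase, ← hp, Finset.sdiff_sdiff_eq_self hF.1]
  have hGeq : ∀ T ∈ 𝒯, ∀ᵐ x ∂(volume.restrict (simplexHull T)),
      G x i = MvPolynomial.eval (fun j => x j) (MvPolynomial.pderiv i (P T)) := fun T hT => by
    rw [← restrict_interior_simplexHull]
    filter_upwards [(hG T hT).unique isOpen_interior (isBounded_interior_simplexHull T)
      (hP.hasWeakGradient hT)] with x hx
    rw [hx, EuclideanSpace.gradient_apply _ ((P T).contDiff_eval.differentiable one_ne_zero x),
      ← polyDirDeriv_eq_fderiv, polyDirDeriv_single]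
  refine ⟨fun T => MvPolynomial.pderiv i (P T), ⟨?_, ?_, hGeq⟩, ?_, ?_⟩
  · exact h.memLp_two_of_forall fun T hT => (hG T hT).memLp_gradient.eval_piLp i
  · intro T hT
    have h1 := MvPolynomial.totalDegree_pderiv_le i (P T)
    have h2 := hP.totalDegree_le T hT
    omega
  · intro F T₁ T₂ hF
    obtain ⟨p, hp, rfl⟩ := hface hF.left_mem hF.left
    have hP1 := hP.totalDegree_le T₁ hF.left_mem
    have hP2 := hP.totalDegree_le T₂ hF.right_mem
    obtain ⟨m, hm, hmf⟩ := (h.affineIndependent_erase hF.left_mem p).exists_setIntegral_simplexHull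
      hF.left.2
    -- Stated for every direction: it turns the hypothesis on normals into vertex sums, and vertex
    -- sums back into the integral for the `i`-th coordinate direction.
    have hval : ∀ n, ∫ x in simplexHull (T₁.erase p),
        (polyDirDeriv n (P T₁) x - polyDirDeriv n (P T₂) x) ∂μHE[d - 1] =
        m * (∑ q ∈ T₁.erase p, polyDirDeriv n (P T₁) q -
          ∑ q ∈ T₁.erase p, polyDirDeriv n (P T₂) q) := fun n => by
      obtain ⟨f₁, h₁⟩ := exists_affineMap_polyDirDeriv hP1 n
      obtain ⟨f₂, h₂⟩ := exists_affineMap_polyDirDeriv hP2 n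
      simp_rw [h₁, h₂, ← Finset.sum_sub_distrib]
      exact hmf (f₁ - f₂)
    have key := h.sum_polyDirDeriv_eq_zero hF.left_mem hd hp (Finset.univ : Finset Bool)
      (fun b => if b then 1 else -1) (fun b => if b then P T₁ else P T₂)
      (by simp [hP1, hP2])
      (fun n hn => by
        have h0 := hnint _ T₁ T₂ hF n hn
        rw [hval] at h0
        simpa [sub_eq_add_neg] using (mul_eq_zero.1 h0).resolve_left hm.ne')
      (fun S hS => by
        have := hSint S T₁ hF.left_mem T₂ hF.right_mem ⟨hS.1.trans hF.left.1, hS.2⟩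
          ⟨hS.1.trans hF.right.1, hS.2⟩
        simp [this])
      (EuclideanSpace.single i 1)
    simp_rw [← polyDirDeriv_single]
    rw [hval]
    simp only [Fintype.sum_bool, if_true, Bool.false_eq_true, if_false] at key
    rw [show ∑ q ∈ T₁.erase p, polyDirDeriv (EuclideanSpace.single i 1) (P T₁) q -
      ∑ q ∈ T₁.erase p, polyDirDeriv (EuclideanSpace.single i 1) (P T₂) q = 0 by linarith, mul_zero]
  · intro F T hF
    obtain ⟨p, hp, rfl⟩ := hface hF.mem hF.face
    have hPT := hP.totalDegree_le T hF.mem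
    have hind := h.affineIndependent_erase hF.mem p
    obtain ⟨m, hm, hmf⟩ := hind.exists_setIntegral_simplexHull hF.face.2
    have key := h.sum_polyDirDeriv_eq_zero hF.mem hd hp (Finset.univ : Finset Unit)
      (fun _ => 1) (fun _ => P T) (by simpa using hPT)
      (fun n hn => by
        have h0 := hnbd _ T hF n hn
        obtain ⟨f, hf⟩ := exists_affineMap_polyDirDeriv hPT n
        simp_rw [hf] at h0 ⊢
        rw [hind.setAverage_simplexHull hF.face.2, div_eq_zero_iff] at h0
        have hc : ((T.erase p).card : ℝ) ≠ 0 := by rw [hF.face.2]; positivity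
        simpa using h0.resolve_right hc)
      -- Every subsimplex of a boundary face also lies in the boundary, so its average vanishes.
      (fun S hS => by
        have := hSbd S T hF.mem ⟨hS.1.trans hF.face.1, hS.2⟩
          ((convexHull_mono (Finset.coe_subset.2 hS.1)).trans hF.boundary)
        simp [this])
      (EuclideanSpace.single i 1)
    simp_rw [← polyDirDeriv_single]
    obtain ⟨f, hf⟩ := exists_affineMap_polyDirDeriv hPT (EuclideanSpace.single i 1)
    simp_rw [hf] at key ⊢
    rw [hmf f]
    simp only [Finset.univ_unique, Finset.sum_singleton, one_mul] at key
    rw [key, mul_zero]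

lemma exists_hasBrokenDivergence_of_mem_RT0Space (h : IsConformingMesh Ω 𝒯)
    {v : EuclideanSpace ℝ (Fin d) → EuclideanSpace ℝ (Fin d)} (hv : v ∈ RT0Space Ω 𝒯) :
    ∃ D, HasBrokenDivergence 𝒯 v D := by
  obtain ⟨-, a, β, hab, -⟩ := hv
  refine h.exists_hasBrokenDivergence (g := fun T _ => d * β T) fun T hT => ?_
  refine (hasWeakDivergence_affine (isBounded_interior_simplexHull T) (a T) (β T)).congr ?_
    (ae_eq_refl _)
  rw [restrict_interior_simplexHull]
  exact (hab T hT).mono fun x hx => hx.symm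

/-- The identity is additive in `ψ`, so the `H10` and Crouzeix-Raviart parts are treated separately;
uniqueness of weak derivatives reduces arbitrary `D` and `G` to the explicit ones. -/
theorem broken_integration_by_parts (hd : 1 ≤ d) (hΩ : IsPolyhedralDomain Ω)
    (h : IsConformingMesh Ω 𝒯) {v : EuclideanSpace ℝ (Fin d) → EuclideanSpace ℝ (Fin d)}
    (hv : v ∈ RT0Space Ω 𝒯) {D : EuclideanSpace ℝ (Fin d) → ℝ} (hD : HasBrokenDivergence 𝒯 v D)
    {ψ : EuclideanSpace ℝ (Fin d) → ℝ} (hψ : ψ ∈ H10 Ω + CR0Space Ω 𝒯) :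
    (∃ G, HasBrokenGradient 𝒯 ψ G) ∧ ∀ G, HasBrokenGradient 𝒯 ψ G →
      (∀ T ∈ 𝒯, IntegrableOn (fun x => inner ℝ (v x) (G x)) (simplexHull T) ∧
        IntegrableOn (fun x => D x * ψ x) (simplexHull T)) ∧
      (∑ T ∈ 𝒯, ∫ x in simplexHull T, inner ℝ (v x) (G x)) +
        (∑ T ∈ 𝒯, ∫ x in simplexHull T, D x * ψ x) = 0 := by
  classical
  obtain ⟨-, a, β, hab, hn⟩ := hv
  obtain ⟨w, hw, χ, ⟨P, hP, hint, hbd⟩, rfl⟩ := Set.mem_add.1 hψ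
  obtain ⟨Gw, hGw, hsumw⟩ := h.sum_setIntegral_H10_eq_zero hΩ hd hn hw
  have hsumP := h.sum_setIntegral_polynomial_eq_zero hΩ.isOpen hd hn hP.totalDegree_le hint hbd
  set g : Finset (EuclideanSpace ℝ (Fin d)) → EuclideanSpace ℝ (Fin d) → ℝ := fun T x =>
    MvPolynomial.eval (fun i => x i) (P T) with hg
  have hgrad : ∀ T ∈ 𝒯, HasWeakGradient (interior (simplexHull T)) (w + χ)
      (fun x => Gw x + gradient (g T) x) := fun T hT =>
    (hGw T hT).add (isBounded_interior_simplexHull T) (hP.hasWeakGradient hT)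
  refine ⟨h.exists_hasBrokenGradient hgrad, fun G hG => ⟨fun T hT => ?_, ?_⟩⟩
  · rw [IntegrableOn, IntegrableOn, ← restrict_interior_simplexHull]
    exact ⟨(hD T hT).memLp.integrable_inner_two (hG T hT).memLp_gradient,
      (hD T hT).memLp_divergence.integrable_mul_two (hG T hT).memLp⟩
  -- The right-hand `0` is rewritten as the sum of the two vanishing sums, which leaves an identity
  -- on each element.
  · rw [← add_zero (0 : ℝ)]
    nth_rw 1 [← hsumw]
    rw [← hsumP, ← Finset.sum_add_distrib, ← Finset.sum_add_distrib]
    refine Finset.sum_congr rfl fun T hT => ?_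
    have hb := isBounded_interior_simplexHull T
    rw [← restrict_interior_simplexHull]
    have hvT : ∀ᵐ x ∂(volume.restrict (interior (simplexHull T))), v x = a T + β T • x := by
      rw [restrict_interior_simplexHull]; exact hab T hT
    have hχT : ∀ᵐ x ∂(volume.restrict (interior (simplexHull T))), χ x = g T x := by
      rw [restrict_interior_simplexHull]; exact hP.eq_poly T hT
    have hGT := (hG T hT).unique isOpen_interior hb (hgrad T hT)
    have hDT := (hD T hT).unique isOpen_interior hb
      ((hasWeakDivergence_affine hb (a T) (β T)).congr (hvT.mono fun x hx => hx.symm)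
        (ae_eq_refl _))
    have hg1 : ContDiff ℝ 1 (g T) := (P T).contDiff_eval
    have hav : MemLp (fun x => a T + β T • x) 2 (volume.restrict (interior (simplexHull T))) :=
      Continuous.memLp_restrict_of_isBounded (by fun_prop) hb 2
    have hβ : MemLp (fun _ => d * β T) 2
        (volume.restrict (interior (simplexHull T)) : Measure (EuclideanSpace ℝ (Fin d))) :=
      Continuous.memLp_restrict_of_isBounded continuous_const hb 2
    have hgg := hg1.continuous_gradient.memLp_restrict_of_isBounded hb 2
    have hg2 := hg1.continuous.memLp_restrict_of_isBounded hb 2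
    have e1 : ∫ x in interior (simplexHull T), inner ℝ (v x) (G x) =
        (∫ x in interior (simplexHull T), inner ℝ (a T + β T • x) (Gw x)) +
          ∫ x in interior (simplexHull T), inner ℝ (a T + β T • x) (gradient (g T) x) := by
      rw [← integral_add (hav.integrable_inner_two (hGw T hT).memLp_gradient)
        (hav.integrable_inner_two hgg)]
      refine integral_congr_ae ?_
      filter_upwards [hvT, hGT] with x h1 h2
      rw [h1, h2, inner_add_right]
    have e2 : ∫ x in interior (simplexHull T), D x * (w + χ) x =
        (∫ x in interior (simplexHull T), d * β T * w x) +
          ∫ x in interior (simplexHull T), d * β T * g T x := by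
      rw [← integral_add (hβ.integrable_mul_two (hGw T hT).memLp) (hβ.integrable_mul_two hg2)]
      refine integral_congr_ae ?_
      filter_upwards [hDT, hχT] with x h1 h2
      rw [h1, Pi.add_apply, h2, mul_add]
    have e3 : ∫ x in interior (simplexHull T),
        (fderiv ℝ (g T) x (a T + β T • x) + d * β T * g T x) =
        (∫ x in interior (simplexHull T), inner ℝ (a T + β T • x) (gradient (g T) x)) +
          ∫ x in interior (simplexHull T), d * β T * g T x := by
      rw [← integral_add (hav.integrable_inner_two hgg) (hβ.integrable_mul_two hg2)]
      congr 1
      ext x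
      rw [inner_gradient_right, conj_trivial]
    rw [e1, e2]
    refine Eq.trans ?_ (congrArg _ e3.symm)
    ring

end Mesh

theorem mainTheorem9 (d : ℕ) (hd : d = 2 ∨ d = 3)
    (Ω : Set (EuclideanSpace ℝ (Fin d))) (hΩ : IsPolyhedralDomain Ω)
    (𝒯 : Finset (Finset (EuclideanSpace ℝ (Fin d)))) (h𝒯 : IsConformingMesh Ω 𝒯)
    (v : EuclideanSpace ℝ (Fin d) → EuclideanSpace ℝ (Fin d)) (hv : v ∈ RT0Space Ω 𝒯) :
    (∃ D, HasBrokenDivergence 𝒯 v D) ∧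
    ∀ D, HasBrokenDivergence 𝒯 v D →
      (∀ ψ ∈ H10 Ω + CR0Space Ω 𝒯,
        (∃ G, HasBrokenGradient 𝒯 ψ G) ∧
        ∀ G, HasBrokenGradient 𝒯 ψ G →
          (∀ T ∈ 𝒯, IntegrableOn (fun x => inner ℝ (v x) (G x)) (simplexHull T) ∧
            IntegrableOn (fun x => D x * ψ x) (simplexHull T)) ∧
          (∑ T ∈ 𝒯, ∫ x in simplexHull T, inner ℝ (v x) (G x)) +
            (∑ T ∈ 𝒯, ∫ x in simplexHull T, D x * ψ x) = 0) ∧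
      (∀ φ ∈ Morley0Space Ω 𝒯,
        (∃ G, HasBrokenGradient 𝒯 φ G) ∧
        ∀ G, HasBrokenGradient 𝒯 φ G → ∀ i : Fin d,
          (∃ H, HasBrokenGradient 𝒯 (fun x => G x i) H) ∧
          ∀ H, HasBrokenGradient 𝒯 (fun x => G x i) H →
            (∀ T ∈ 𝒯, IntegrableOn (fun x => inner ℝ (v x) (H x)) (simplexHull T) ∧
              IntegrableOn (fun x => D x * G x i) (simplexHull T)) ∧
            (∑ T ∈ 𝒯, ∫ x in simplexHull T, inner ℝ (v x) (H x)) +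
              (∑ T ∈ 𝒯, ∫ x in simplexHull T, D x * G x i) = 0) := by
  have hd1 : 1 ≤ d := by omega
  refine ⟨exists_hasBrokenDivergence_of_mem_RT0Space h𝒯 hv, fun D hD =>
    ⟨fun ψ hψ => broken_integration_by_parts hd1 hΩ h𝒯 hv hD hψ, fun φ hφ => ⟨?_, fun G hG i => ?_⟩⟩⟩
  · obtain ⟨P, hP, -⟩ := hφ
    exact h𝒯.exists_hasBrokenGradient fun T hT => hP.hasWeakGradient hT
  · refine broken_integration_by_parts hd1 hΩ h𝒯 hv hD ?_
    -- The derivative of a Morley function enters with zero `H10` part.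
    exact Set.mem_add.2 ⟨0, zero_mem_H10 Ω, _, Morley0Space.apply_mem_CR0Space h𝒯 hd hφ hG i,
      zero_add _⟩
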